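/- Let $V$ be a finite-dimensional vector space over a field $\Bbbk$, viewed as the affine scheme $\operatorname{Spec}\operatorname{Sym}V^*$, and let $L\subseteq V$ be a $1$-dimensional subspace. Let $Bl_L\overline V$ be the blow-up of the projective completion $\overline V=\mathbb P(V\oplus\Bbbk)=V\cup\mathbb P V$ at the point $\mathbb P L\in\mathbb P V$. Equivalently, $Bl_L\overline V$ is the closure in $\mathbb P(V\oplus\Bbbk)\times_{\Bbbk}\mathbb P(V/L\oplus\Bbbk)$ of the graph of the linear projection $\mathbb P(V\oplus\Bbbk)\dashrightarrow\mathbb P(V/L\oplus\Bbbk)$ from $\mathbb P L$. Its exceptional divisor (the preimage of $\mathbb P L$) is identified by the second projection with the projective completion $\mathbb P(V/L\oplus\Bbbk)$ of $V/L$, and so contains a copy of $V/L$. Let $X\subseteq V$ be a closed subscheme with ideal $I$. Let $\Pi\subseteq V/L$ be the scheme-theoretic closure of the image of $X$ in $V/L$, let $\overline X$ be the closure of $X$ in $Bl_L\overline V$, and let $\Lambda=\overline X\cap V/L$, the scheme-theoretic intersection in $Bl_L\overline V$ with the copy of $V/L$ in the exceptional divisor. For a closed subscheme $Z\subseteq V/L$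 let $Z\times L\subseteq V$ be its preimage under $V\to V/L$. For a hyperplane $H$ complementary to $L$ in $V$, let $Z\times\{0\}\subseteq V$ be the image of $Z$ under $V/L\cong H\subseteq V$, and let $X'=\lim_{t\to0}t\cdot X$ be the flat limit of $X$ under the action $t\cdot(\vec h,l)=(\vec h,tl)$ of $\Bbbk^\times$ that scales $L$ and fixes $H$, that is, the fibre over $t=0$ of the closure in $V\times\mathbb A^1$ of the family $\{t\cdot X\}_{t\ne0}$. Then the following hold. (a) For every hyperplane $H$ complementary to $L$, the scheme-theoretic intersection of $\Pi\times\{0\}$ and $\Lambda\times L$ in $V$ is $\Lambda\times\{0\}$, and as schemes $$X'\supseteq(\Pi\times\{0\})\cup_{\Lambda\times\{0\}}(\Lambda\times L),$$ where the right-hand side is the scheme-theoretic union in $V$, defined by the intersection of the two ideals. (b) The containment in (a) is an equality of underlying sets. (c) Suppose that $I$ is homogeneous for the standard grading of $\operatorname{Sym}V^*$. Then the ideals of $\Pi$ and $\Lambda$ in $\operatorname{Sym}(V/L)^*$ are homogeneous. Moreover, writing $h_Y(s)=\sum_{n\ge0}\dim_{\Bbbk}\bigl((\operatorname{Sym}V^*/I_Y)_n\bigr)s^n$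 for the Hilbert series of a closed subscheme $Y\subseteq V$ with homogeneous ideal $I_Y$, the inequality $$h_X(s)\ \ge\ (1-s)\,h_{\Pi\times L}(s)+s\,h_{\Lambda\times L}(s)$$ holds coefficient by coefficient. (d) If, for some hyperplane $H$ complementary to $L$, the flat limit $X'$ is reduced, then for this $H$ the containment in (a) is an equality of schemes and, if $I$ is homogeneous, the inequality in (c) is an equality. -/

import Mathlib

/-! Closed subschemes of a finite-dimensional vector space `V`, regarded as the affine scheme
`Spec (Sym V*)`, are represented by their ideals.  Thus inclusion of subschemes is reversed
inclusion of ideals, the scheme-theoretic union is the intersection `⊓` of ideals, and the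
scheme-theoretic intersection is the sum `⊔` of ideals. -/

universe u

noncomputable section

namespace LineDegeneration

open CategoryTheory AlgebraicGeometry

section Affine

variable (k V : Type u) [Field k] [AddCommGroup V] [Module k V]

/-- The coordinate ring `k[V] = Sym V*` of the scheme `V`. -/
abbrev CoordRing : Type u := SymmetricAlgebra k (Module.Dual k V)

/-- The polynomial functions of degree `n`: the span of products of `n` linear forms. -/
abbrev homogeneousPart (n : ℕ) : Submodule k (CoordRing k V) :=
  LinearMap.range (SymmetricAlgebra.ι k (Module.Dual k V)) ^ n

/-- A linear form, as an element of degree one of the graded ring. -/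
def gradedForm : Module.Dual k V →ₗ[k] DirectSum ℕ fun n => ↥(homogeneousPart k V n) :=
  DirectSum.lof k ℕ (fun n => ↥(homogeneousPart k V n)) 1 ∘ₗ
    (SymmetricAlgebra.ι k (Module.Dual k V)).codRestrict _ fun m => by
      simpa only [pow_one] using LinearMap.mem_range_self _ m

theorem gradedForm_apply (m : Module.Dual k V) :
    gradedForm k V m = DirectSum.of (fun n : ℕ => ↥(homogeneousPart k V n)) 1
      ⟨SymmetricAlgebra.ι k _ m, by simpa only [pow_one] using LinearMap.mem_range_self _ m⟩ :=
  rfl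

/-- The standard grading of `k[V]`, in which all linear forms have degree one. -/
instance gradedAlgebra : GradedAlgebra (homogeneousPart k V) :=
  GradedAlgebra.ofAlgHom _ (SymmetricAlgebra.lift (gradedForm k V))
    (by
      apply SymmetricAlgebra.algHom_ext
      ext m
      change DirectSum.coeAlgHom (homogeneousPart k V)
        (SymmetricAlgebra.lift (gradedForm k V) (SymmetricAlgebra.ι k _ m)) =
          SymmetricAlgebra.ι k _ m
      rw [SymmetricAlgebra.lift_ι_apply, gradedForm_apply, DirectSum.coeAlgHom_of])
    fun i x => by
    obtain ⟨x, hx⟩ := x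
    dsimp only [Subtype.coe_mk, DirectSum.lof_eq_of]
    induction hx using Submodule.pow_induction_on_left' with
    | algebraMap r =>
      rw [AlgHom.commutes, DirectSum.algebraMap_apply]; rfl
    | add x y i hx hy ihx ihy =>
      rw [map_add, ihx, ihy, ← map_add]
      rfl
    | mem_mul m hm i x hx ih =>
      obtain ⟨_, rfl⟩ := hm
      rw [map_mul, ih, SymmetricAlgebra.lift_ι_apply, gradedForm_apply, DirectSum.of_mul_of]
      exact DirectSum.of_eq_of_gradedMonoid_eq (Sigma.subtype_ext (add_comm _ _) rfl)

/-- The scheme `V`. -/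
abbrev affineSpace : Scheme.{u} := Spec (.of (CoordRing k V))

variable {k V}

/-- Composition of polynomial functions with a linear map `f : V → W`. -/
def pullbackHom {W : Type u} [AddCommGroup W] [Module k W] (f : V →ₗ[k] W) :
    CoordRing k W →ₐ[k] CoordRing k V :=
  SymmetricAlgebra.lift (SymmetricAlgebra.ι k (Module.Dual k V) ∘ₗ f.dualMap)

/-- The Hilbert series of the closed subscheme of `V` with homogeneous ideal `I`: the coefficient
of `s ^ n` is the dimension of `(k[V] / I)_n`, the image of `k[V]_n` in `k[V] / I`. -/
def hilbertSeries (I : Ideal (CoordRing k V)) : PowerSeries ℤ :=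
  PowerSeries.mk fun n =>
    (Module.finrank k
      ↥((homogeneousPart k V n).map (Ideal.Quotient.mkₐ k I).toLinearMap) : ℤ)

end Affine

section Projective

variable {k W : Type u} [Field k] [AddCommGroup W] [Module k W]

variable (k W) in
/-- The projective space of lines in `W`. -/
abbrev projectiveSpace : Scheme.{u} := Proj (homogeneousPart k W)

variable (k W) in
/-- The structure morphism of the projective space of lines in `W`. -/
def projectiveSpaceToSpec : projectiveSpace k W ⟶ Spec (.of k) :=
  Proj.toSpecZero (homogeneousPart k W) ≫
    Spec.map (CommRingCat.ofHom (algebraMap k ↥(homogeneousPart k W 0)))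

variable {A : Type u} [CommRing A] [Algebra k A]

theorem map_irrelevant_eq_top (θ : Module.Dual k W →ₗ[k] A)
    (hθ : Ideal.span (Set.range θ) = ⊤) :
    (HomogeneousIdeal.irrelevant (homogeneousPart k W)).toIdeal.map
      ((Scheme.ΓSpecIso (.of A)).inv.hom.comp
        (SymmetricAlgebra.lift θ : CoordRing k W →ₐ[k] A).toRingHom) = ⊤ := by
  rw [← Ideal.map_map]
  suffices h : (HomogeneousIdeal.irrelevant (homogeneousPart k W)).toIdeal.map
      (SymmetricAlgebra.lift θ : CoordRing k W →ₐ[k] A).toRingHom = ⊤ by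
    rw [h, Ideal.map_top]
  rw [eq_top_iff, ← hθ, Ideal.span_le]
  rintro _ ⟨φ, rfl⟩
  have h1 : SymmetricAlgebra.ι k (Module.Dual k W) φ ∈
      (HomogeneousIdeal.irrelevant (homogeneousPart k W)).toIdeal :=
    HomogeneousIdeal.mem_irrelevant_of_mem (homogeneousPart k W) (i := 1) one_pos
      (by rw [homogeneousPart, pow_one]; exact LinearMap.mem_range_self _ φ)
  have h2 := Ideal.mem_map_of_mem
    (SymmetricAlgebra.lift θ : CoordRing k W →ₐ[k] A).toRingHom h1
  simpa using h2

/-- A family of vectors of `W` parametrized by `Spec A`, given by the values `θ φ` of its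
coordinates `φ ∈ W*`, and vanishing nowhere, spans a family of lines, that is, defines a morphism
from `Spec A` to the projective space of `W`. -/
def toProjectiveSpace (θ : Module.Dual k W →ₗ[k] A) (hθ : Ideal.span (Set.range θ) = ⊤) :
    Spec (.of A) ⟶ projectiveSpace k W :=
  Proj.fromOfGlobalSections (homogeneousPart k W)
    ((Scheme.ΓSpecIso (.of A)).inv.hom.comp
      (SymmetricAlgebra.lift θ : CoordRing k W →ₐ[k] A).toRingHom)
    (map_irrelevant_eq_top θ hθ)

theorem toProjectiveSpace_toSpec (θ : Module.Dual k W →ₗ[k] A)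
    (hθ : Ideal.span (Set.range θ) = ⊤) :
    toProjectiveSpace θ hθ ≫ projectiveSpaceToSpec k W =
      Spec.map (CommRingCat.ofHom (algebraMap k A)) := by
  have h : ((SymmetricAlgebra.lift θ : CoordRing k W →ₐ[k] A).toRingHom.comp
      (algebraMap ↥(homogeneousPart k W 0) (CoordRing k W))).comp
        (algebraMap k ↥(homogeneousPart k W 0)) = algebraMap k A := by
    ext r
    exact (SymmetricAlgebra.lift θ : CoordRing k W →ₐ[k] A).commutes r
  rw [toProjectiveSpace, projectiveSpaceToSpec, Proj.fromOfGlobalSections_toSpecZero_assoc,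
    ← Spec.map_comp, ← h]
  rw [← SpecMap_ΓSpecIso_hom, ← Spec.map_comp]
  congr 1
  ext r
  simp

end Projective

section Completion

variable (k V : Type u) [Field k] [AddCommGroup V] [Module k V]

/-- The projective completion `P(V ⊕ k) = V ∪ P(V)` of `V`. -/
abbrev completion : Scheme.{u} := projectiveSpace k (V × k)

/-- The coordinates of the vector `(v, 1)` of `V ⊕ k`, for `v` the generic point of `V`. -/
def inclusionCoords : Module.Dual k (V × k) →ₗ[k] CoordRing k V :=
  SymmetricAlgebra.ι k (Module.Dual k V) ∘ₗ (LinearMap.inl k V k).dualMap +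
    Algebra.linearMap k (CoordRing k V) ∘ₗ Module.Dual.eval k (V × k) (0, 1)

theorem span_range_inclusionCoords : Ideal.span (Set.range (inclusionCoords k V)) = ⊤ := by
  rw [Ideal.eq_top_iff_one]
  refine Ideal.subset_span ⟨LinearMap.snd k V k, ?_⟩
  have h : (LinearMap.inl k V k).dualMap (LinearMap.snd k V k) = 0 := by ext; simp
  change SymmetricAlgebra.ι k (Module.Dual k V)
      ((LinearMap.inl k V k).dualMap (LinearMap.snd k V k)) +
    algebraMap k (CoordRing k V) 1 = 1
  rw [h, map_zero, zero_add, map_one]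

/-- The open immersion of `V` in its projective completion, `v ↦ [v : 1]`. -/
def inclusion : affineSpace k V ⟶ completion k V :=
  toProjectiveSpace (inclusionCoords k V) (span_range_inclusionCoords k V)

end Completion

section BlowUp

variable {k V : Type u} [Field k] [AddCommGroup V] [Module k V] (L : Submodule k V)


theorem exists_spanningVector (hL : Module.finrank k L = 1) : ∃ v ∈ L, v ≠ 0 := by
  by_contra! h
  have : L = ⊥ := (Submodule.eq_bot_iff L).2 h
  rw [this, finrank_bot] at hL
  exact zero_ne_one hL

/-- A nonzero vector of the line `L`. -/
def spanningVector (hL : Module.finrank k L = 1) : V := (exists_spanningVector L hL).choose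

theorem spanningVector_mem (hL : Module.finrank k L = 1) : spanningVector L hL ∈ L :=
  (exists_spanningVector L hL).choose_spec.1

theorem spanningVector_ne_zero (hL : Module.finrank k L = 1) : spanningVector L hL ≠ 0 :=
  (exists_spanningVector L hL).choose_spec.2

theorem span_range_center (hL : Module.finrank k L = 1) :
    Ideal.span (Set.range (Module.Dual.eval k (V × k) (spanningVector L hL, 0))) = ⊤ := by
  obtain ⟨φ, hφ⟩ := Module.Projective.exists_dual_ne_zero k (spanningVector_ne_zero L hL)
  refine Ideal.eq_top_of_isUnit_mem _ (Ideal.subset_span ⟨φ ∘ₗ LinearMap.fst k V k, rfl⟩) ?_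
  exact isUnit_iff_ne_zero.2 hφ

/-- The point `P(L)` of the hyperplane at infinity `P(V)` of the projective completion of `V`. -/
def center (hL : Module.finrank k L = 1) : Spec (.of k) ⟶ completion k V :=
  toProjectiveSpace (Module.Dual.eval k (V × k) (spanningVector L hL, 0)) (span_range_center L hL)

/-- The linear projection `V → V / L`. -/
def quotientMap : affineSpace k V ⟶ affineSpace k (V ⧸ L) :=
  Spec.map (CommRingCat.ofHom (pullbackHom L.mkQ).toRingHom)

/-- The product over `k` of the projective completions of `V` and `V / L`. -/
abbrev completionProduct : Scheme.{u} :=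
  Limits.pullback (projectiveSpaceToSpec k (V × k)) (projectiveSpaceToSpec k ((V ⧸ L) × k))

/-- The graph, over the dense open subscheme `V` of `P(V ⊕ k)`, of the rational map from
`P(V ⊕ k)` to `P(V / L ⊕ k)` given by linear projection from the point `P(L)`. -/
def graph : affineSpace k V ⟶ completionProduct L :=
  Limits.pullback.lift (inclusion k V) (quotientMap L ≫ inclusion k (V ⧸ L)) (by
    rw [Category.assoc, inclusion, inclusion, toProjectiveSpace_toSpec, toProjectiveSpace_toSpec,
      quotientMap, ← Spec.map_comp]
    congr 1
    ext r
    exact ((pullbackHom L.mkQ).commutes r).symm)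

/-- The blow-up of `P(V ⊕ k)` at the point `P(L)`: the closure, in the product of `P(V ⊕ k)` and
`P(V / L ⊕ k)`, of the graph of the linear projection from that point. -/
abbrev blowUp : Scheme.{u} := (graph L).image

/-- The inclusion of `V`, as an open subscheme, in the blow-up. -/
def toBlowUp : affineSpace k V ⟶ blowUp L := (graph L).toImage

/-- The blow-down morphism to `P(V ⊕ k)`. -/
def blowDown : blowUp L ⟶ completion k V := (graph L).imageι ≫ Limits.pullback.fst _ _

/-- The morphism from the blow-up to `P(V / L ⊕ k)` that extends the linear projection. -/
def resolvedProjection : blowUp L ⟶ completion k (V ⧸ L) :=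
  (graph L).imageι ≫ Limits.pullback.snd _ _

variable (hL : Module.finrank k L = 1)

/-- The exceptional divisor, that is, the preimage of the point `P(L)` in the blow-up. -/
abbrev exceptionalDivisor : Scheme.{u} := Limits.pullback (blowDown L) (center L hL)

/-- The natural identification of the exceptional divisor with the projective completion
of `V / L`. -/
def exceptionalDivisorToCompletion : exceptionalDivisor L hL ⟶ completion k (V ⧸ L) :=
  Limits.pullback.fst _ _ ≫ resolvedProjection L

/-- The copy of `V / L` in the exceptional divisor: the open subscheme that corresponds to the open
subscheme `V / L` of its projective completion. -/
abbrev exceptionalChart : Scheme.{u} :=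
  Limits.pullback (exceptionalDivisorToCompletion L hL) (inclusion k (V ⧸ L))

/-- The inclusion in the blow-up of the copy of `V / L` in the exceptional divisor. -/
def exceptionalChartToBlowUp : exceptionalChart L hL ⟶ blowUp L :=
  Limits.pullback.fst _ _ ≫ Limits.pullback.fst _ _

/-- The natural identification of the copy of `V / L` in the exceptional divisor with `V / L`. -/
def exceptionalChartToQuotient : exceptionalChart L hL ⟶ affineSpace k (V ⧸ L) :=
  Limits.pullback.snd _ _

/-- The ideal of the scheme-theoretic image of a morphism to an affine scheme `Spec A`; for a
closed immersion, the ideal that defines it. -/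
def idealOfImage {A : Type u} [CommRing A] {Z : Scheme.{u}} (f : Z ⟶ Spec (.of A)) : Ideal A :=
  RingHom.ker ((Scheme.ΓSpecIso (.of A)).inv ≫ f.appTop).hom

variable (I : Ideal (CoordRing k V))

/-- The closed subscheme `X` of `V` with ideal `I`, mapped to the blow-up. -/
def subschemeToBlowUp : Spec (.of (CoordRing k V ⧸ I)) ⟶ blowUp L :=
  Spec.map (CommRingCat.ofHom (Ideal.Quotient.mk I)) ≫ toBlowUp L

/-- The closure of `X` in the blow-up. -/
abbrev closureInBlowUp : Scheme.{u} := (subschemeToBlowUp L I).image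

/-- The scheme `Λ`, the intersection in the blow-up of the closure of `X` with the copy of `V / L`
in the exceptional divisor. -/
abbrev intersectionAtInfinity : Scheme.{u} :=
  Limits.pullback (subschemeToBlowUp L I).imageι (exceptionalChartToBlowUp L hL)

/-- The ideal of `Λ` as a closed subscheme of `V / L`. -/
def lambdaIdeal : Ideal (CoordRing k (V ⧸ L)) :=
  idealOfImage (Limits.pullback.snd (subschemeToBlowUp L I).imageι (exceptionalChartToBlowUp L hL) ≫
    exceptionalChartToQuotient L hL)

/-- The ideal of `Π`, the scheme-theoretic closure of the image of `X` in `V / L`. -/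
def projectionIdeal : Ideal (CoordRing k (V ⧸ L)) :=
  I.comap (pullbackHom L.mkQ)

end BlowUp

section Splitting

open LaurentPolynomial

variable {k V : Type u} [Field k] [AddCommGroup V] [Module k V]

variable {L H : Submodule k V}

/-- The closed subscheme `Z × L` of `V`, for a closed subscheme `Z` of `V / L` with ideal `J`: the
preimage of `Z` under `V → V / L`. -/
def cylinderIdeal (L : Submodule k V) (J : Ideal (CoordRing k (V ⧸ L))) : Ideal (CoordRing k V) :=
  J.map (pullbackHom L.mkQ)

/-- The closed subscheme `Z × {0}` of `V = H × L`, for a closed subscheme `Z` of `V / L` with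
ideal `J`: the image of `Z` under the embedding `V / L ≅ H ⊆ V`. -/
def horizontalIdeal (hLH : IsCompl L H) (J : Ideal (CoordRing k (V ⧸ L))) :
    Ideal (CoordRing k V) :=
  J.comap (pullbackHom (H.subtype ∘ₗ (L.quotientEquivOfIsCompl H hLH).toLinearMap))

/-- The homomorphism that maps a function `f` on `V = H × L` to the function
`(v, t) ↦ f (t⁻¹ · v)` on the product of `V` and the punctured line, where `t · (h, l) = (h, t l)`
is the action that scales `L` and fixes `H`. -/
def inverseScaling (hLH : IsCompl L H) : CoordRing k V →ₐ[k] (CoordRing k V)[T;T⁻¹] :=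
  SymmetricAlgebra.lift
    { toFun := fun φ =>
        C (SymmetricAlgebra.ι k (Module.Dual k V) (φ ∘ₗ H.projection L hLH.symm)) +
          C (SymmetricAlgebra.ι k (Module.Dual k V) (φ ∘ₗ L.projection H hLH)) * T (-1)
      map_add' := fun φ ψ => by
        simp only [LinearMap.add_comp, map_add]; ring
      map_smul' := fun c φ => by
        simp only [LinearMap.smul_comp, map_smul, RingHom.id_apply,
          ← LaurentPolynomial.algebraMap_apply, Algebra.smul_def, map_mul, mul_assoc]
        exact (mul_add _ _ _).symm }

/-- The family `t · X` over the punctured line, as a closed subscheme of the product of `V` and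
the punctured line. -/
def scaledFamilyIdeal (hLH : IsCompl L H) (I : Ideal (CoordRing k V)) :
    Ideal (CoordRing k V)[T;T⁻¹] :=
  I.map (inverseScaling hLH)

/-- The closure of the family `t · X` in the product of `V` and the line. -/
def familyClosureIdeal (hLH : IsCompl L H) (I : Ideal (CoordRing k V)) :
    Ideal (Polynomial (CoordRing k V)) :=
  (scaledFamilyIdeal hLH I).comap (Polynomial.toLaurent (R := CoordRing k V))

/-- The flat limit of `t · X` for `t → 0`, that is, the fibre at `t = 0` of the closure of the
family `t · X`. -/
def flatLimitIdeal (hLH : IsCompl L H) (I : Ideal (CoordRing k V)) : Ideal (CoordRing k V) :=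
  (familyClosureIdeal hLH I).map (Polynomial.evalRingHom 0)

end Splitting

end LineDegeneration

end

/-!
Choose a complement `H` of `L` and the linear form `ℓ` on `V` that vanishes on `H` and is one at a
chosen vector of `L`.  Then `k[V] = R[ℓ]` with `R = k[V / L]` (`splitEquiv`).  Everything in the
theorem is read off from the ideals `I_n ⊆ R` of coefficients of `ℓ ^ n` in the elements of `I` of
degree at most `n` in `ℓ`.  They form an increasing sequence.

* The ideal of `Π` is `I ∩ R = I_0`.
* The ideal of `Λ` is the union of all `I_n` (`mem_lambdaIdeal_iff`).  For this, the copy of `V / L`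
  in the exceptional divisor is covered by a chart `V / L × A¹` of the blow-up with coordinate
  `u = ℓ⁻¹` on the line, which is closed in an affine open subset of the product of the
  projective completions (`infinityChartLift`), and the copy of `V / L` is given by `u = 0`
  (`quotientAtInfinity_eq`).  In this chart, the closure of `X` is the closure of the part of `X`
  where `ℓ` is invertible (`ker_subschemeToProduct_comap`), so its ideal consists of the polynomials
  `g` in `u` such that `ℓ ^ n * g (ℓ⁻¹)` lies in `I` for large `n`; the value of `g` at `u = 0` is
  the coefficient of `ℓ ^ n`.
* The ideal of the flat limit is the sum of all `I_n ℓ ^ n` (`mem_flatLimitIdeal_iff`), as scaling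
  replaces `ℓ` by `ℓ / t`.

The ideals of `Π × {0}` and `Λ × L` consist of the polynomials with constant coefficient in `I_0`,
and with all coefficients in the union of the `I_n`.  This gives the intersection and the
containment.  If `r ∈ I_d` and `n > 0`, then `(r ℓ ^ n) ^ (d + 1)` lies in the ideal of the flat
limit, as `n (d + 1) ≥ d`; so the ideal of the union lies in the radical of that of the flat limit
(`le_radical_flatLimitIdeal`), and the two are equal if the flat limit is reduced.

If `I` is homogeneous, so are all `I_n`, and filtering the graded parts of `I` by the degree in `ℓ`
gives `h_I(s) = ∑ s ^ n h_{I_n}(s)`, where `h_{I_n}` is the Hilbert series of `R / I_n`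
(`gradedCodim_eq_sum`).  The term for `n = 0` is the Hilbert series of `Π`, that is,
`(1 - s) h_{Π × L}(s)`, and the terms for `n > 0` are bounded below by those with the ideal of `Λ`
in place of `I_n`, which add up to `s h_{Λ × L}(s)`.  If the flat limit equals the union, then
`I_n` is the ideal of `Λ` for all `n > 0`, and equality holds.
-/

noncomputable section

namespace LineDegeneration

open CategoryTheory AlgebraicGeometry Limits

/-! ### Affine charts of projective space -/

section ProjCharts

variable {σ : Type*} {A : Type u} [CommRing A] [SetLike σ A] [AddSubgroupClass σ A]
  (𝒜 : ℕ → σ) [GradedRing 𝒜]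

/-- Evaluation of fractions of degree zero with denominator a power of `x` along a ring
homomorphism that maps `x` to a unit. -/
def awayEval {S : Type u} [CommRing S] (f : A →+* S) (x : A) (hx : IsUnit (f x)) :
    HomogeneousLocalization.Away 𝒜 x →+* S :=
  (IsLocalization.Away.lift x hx : Localization.Away x →+* S).comp
    (algebraMap (HomogeneousLocalization.Away 𝒜 x) (Localization.Away x))

theorem awayEval_mk {S : Type u} [CommRing S] (f : A →+* S) {x : A} (hx : IsUnit (f x))
    {d : ℕ} (hd : x ∈ 𝒜 d) (n : ℕ) (a : A) (ha : a ∈ 𝒜 (n • d)) :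
    awayEval 𝒜 f x hx (HomogeneousLocalization.Away.mk 𝒜 hd n a ha) * f x ^ n = f a := by
  rw [awayEval, RingHom.comp_apply, HomogeneousLocalization.algebraMap_apply,
    HomogeneousLocalization.Away.val_mk,
    ← IsLocalization.Away.lift_eq (S := Localization.Away x) x hx a,
    ← IsLocalization.Away.lift_eq (S := Localization.Away x) x hx x, ← map_pow, ← map_mul]
  congr 1
  rw [Localization.mk_eq_mk', ← map_pow]
  exact IsLocalization.mk'_spec _ _ _

/-- If `x` becomes invertible along `g : Spec S ⟶ X`, then the canonical morphism from the open
subscheme `x ≠ 0` of `X` to the spectrum of the localization `Γ(X, ⊤)[1 / x]` restricts along `g` to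
the morphism given by the universal property of the localization. -/
theorem isoOfLocalization_fac {X : Scheme.{u}} {S : Type u} [CommRing S] (g : Spec (.of S) ⟶ X)
    (x : Γ(X, ⊤)) (hx : IsUnit (((Scheme.ΓSpecIso (.of S)).hom.hom.comp g.appTop.hom) x))
    (g' : Spec (.of S) ⟶ (X.basicOpen x).toScheme) (hg : g' ≫ (X.basicOpen x).ι = g) :
    g' ≫ (X.isoOfEq (X.toSpecΓ_preimage_basicOpen x)).inv ≫ X.toSpecΓ ∣_ _ ≫
      (basicOpenIsoSpecAway _).hom =
    Spec.map (CommRingCat.ofHom (IsLocalization.Away.lift (S := Localization.Away x) x hx)) := by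
  rw [← cancel_mono (Spec.map (CommRingCat.ofHom (algebraMap Γ(X, ⊤) (Localization.Away x))))]
  simp only [Category.assoc, basicOpenIsoSpecAway, IsOpenImmersion.isoOfRangeEq_hom_fac]
  rw [← Spec.map_comp, ← CommRingCat.ofHom_comp, IsLocalization.Away.lift_comp]
  refine congr(g' ≫ (X.isoOfEq (X.toSpecΓ_preimage_basicOpen x)).inv ≫
    $(morphismRestrict_ι X.toSpecΓ (PrimeSpectrum.basicOpen x))).trans ?_
  rw [Scheme.isoOfEq_inv_ι_assoc, reassoc_of% hg]
  rw [Scheme.toSpecΓ_naturality, CommRingCat.ofHom_comp, Spec.map_comp]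
  rw [← SpecMap_ΓSpecIso_hom]
  rfl

/-- If a coordinate is invertible, a morphism to `Proj` given by global sections factors through
the corresponding affine chart. -/
theorem comp_fromOfGlobalSections {X : Scheme.{u}} (f : A →+* Γ(X, ⊤))
    (hf : (HomogeneousIdeal.irrelevant 𝒜).toIdeal.map f = ⊤)
    {S : Type u} [CommRing S] (g : Spec (.of S) ⟶ X) {t : A} {d : ℕ} (ht : t ∈ 𝒜 d) (hd : 0 < d)
    (hx : IsUnit (((Scheme.ΓSpecIso (.of S)).hom.hom.comp (g.appTop.hom.comp f)) t)) :
    g ≫ Proj.fromOfGlobalSections 𝒜 f hf =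
      Spec.map (CommRingCat.ofHom
        (awayEval 𝒜 ((Scheme.ΓSpecIso (.of S)).hom.hom.comp (g.appTop.hom.comp f)) t hx)) ≫
        Proj.awayι 𝒜 t ht hd := by
  have hU : g ⁻¹ᵁ (X.basicOpen (f t)) = ⊤ := by
    rw [Scheme.preimage_basicOpen]
    have := hx.map (Scheme.ΓSpecIso (.of S)).inv.hom
    simp only [RingHom.comp_apply, Iso.hom_inv_id_apply] at this
    exact Scheme.basicOpen_of_isUnit _ this
  have hr : Set.range g ⊆ Set.range (X.basicOpen (f t)).ι := by
    rw [Scheme.Opens.range_ι]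
    rintro _ ⟨y, rfl⟩
    have : y ∈ g ⁻¹ᵁ (X.basicOpen (f t)) := by rw [hU]; trivial
    exact this
  have hfac := IsOpenImmersion.lift_fac (X.basicOpen (f t)).ι g hr
  have key := isoOfLocalization_fac g (f t) hx _ hfac
  have h1 : (X.basicOpen (f t)).ι ≫ Proj.fromOfGlobalSections 𝒜 f hf =
      Proj.toBasicOpenOfGlobalSections 𝒜 f rfl hd ht ≫ (Proj.basicOpen 𝒜 t).ι :=
    (Proj.openCoverOfMapIrrelevantEqTop 𝒜 f hf).ι_glueMorphisms _ _ ⟨_, _, hd, ht⟩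
  conv_lhs => rw [← hfac]
  rw [Category.assoc, h1, Proj.toBasicOpenOfGlobalSections]
  simp only [Category.assoc, Proj.basicOpenIsoSpec_inv_ι]
  rw [reassoc_of% key, ← Spec.map_comp_assoc, ← CommRingCat.ofHom_comp]
  congr 3
  rw [awayEval, ← RingHom.comp_assoc]
  congr 1
  refine IsLocalization.ringHom_ext (Submonoid.powers t) ?_
  ext a
  simp

end ProjCharts

section Charts

variable {k W : Type u} [Field k] [AddCommGroup W] [Module k W]
variable {A : Type u} [CommRing A] [Algebra k A] {S : Type u} [CommRing S] [Algebra k S]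

theorem ι_mem_homogeneousPart_one (φ : Module.Dual k W) :
    SymmetricAlgebra.ι k (Module.Dual k W) φ ∈ homogeneousPart k W 1 := by
  rw [homogeneousPart, pow_one]; exact LinearMap.mem_range_self _ φ

/-- The chart of projective space on which a linear form does not vanish. -/
def chart (φ : Module.Dual k W) :
    Spec (.of (HomogeneousLocalization.Away (homogeneousPart k W) (SymmetricAlgebra.ι k _ φ))) ⟶
      projectiveSpace k W :=
  Proj.awayι _ _ (ι_mem_homogeneousPart_one φ) one_pos

instance (φ : Module.Dual k W) : IsOpenImmersion (chart φ) := by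
  unfold chart; infer_instance

theorem lift_ι_isUnit {θ : Module.Dual k W →ₗ[k] S} {φ : Module.Dual k W} (h : IsUnit (θ φ)) :
    IsUnit ((SymmetricAlgebra.lift θ : CoordRing k W →ₐ[k] S).toRingHom
      (SymmetricAlgebra.ι k _ φ)) := by
  simpa using h

/-- The values at a point of the chart of its coordinate functions `a / φ ^ n`. -/
def chartEval (θ : Module.Dual k W →ₗ[k] S) (φ : Module.Dual k W) (h : IsUnit (θ φ)) :
    HomogeneousLocalization.Away (homogeneousPart k W) (SymmetricAlgebra.ι k _ φ) →+* S :=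
  awayEval (homogeneousPart k W) (SymmetricAlgebra.lift θ : CoordRing k W →ₐ[k] S).toRingHom _
    (lift_ι_isUnit h)

/-- On a family of vectors of `W` where the form `φ` is invertible, the morphism to projective
space is computed in the chart `φ ≠ 0`. -/
theorem comp_toProjectiveSpace (θ : Module.Dual k W →ₗ[k] A)
    (hθ : Ideal.span (Set.range θ) = ⊤) (g : A →ₐ[k] S) (φ : Module.Dual k W)
    (h : IsUnit (g (θ φ))) :
    Spec.map (CommRingCat.ofHom g.toRingHom) ≫ toProjectiveSpace θ hθ =
      Spec.map (CommRingCat.ofHom (chartEval (g.toLinearMap ∘ₗ θ) φ h)) ≫ chart φ := by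
  have key : ((Scheme.ΓSpecIso (.of S)).hom.hom.comp
      ((Spec.map (CommRingCat.ofHom g.toRingHom)).appTop.hom.comp
      ((Scheme.ΓSpecIso (.of A)).inv.hom.comp
      (SymmetricAlgebra.lift θ : CoordRing k W →ₐ[k] A).toRingHom))) =
      (SymmetricAlgebra.lift (g.toLinearMap ∘ₗ θ) : CoordRing k W →ₐ[k] S).toRingHom := by
    have h1 : (g.comp (SymmetricAlgebra.lift θ : CoordRing k W →ₐ[k] A)) =
        SymmetricAlgebra.lift (g.toLinearMap ∘ₗ θ) := by
      apply SymmetricAlgebra.algHom_ext; ext; simp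
    rw [← h1]
    have h2 := Scheme.ΓSpecIso_inv_naturality (CommRingCat.ofHom g.toRingHom)
    have h3 : (Scheme.ΓSpecIso (.of A)).inv ≫
        (Spec.map (CommRingCat.ofHom g.toRingHom)).appTop ≫ (Scheme.ΓSpecIso (.of S)).hom =
          CommRingCat.ofHom g.toRingHom := by
      rw [← reassoc_of% h2, Iso.inv_hom_id, Category.comp_id]
    ext a
    exact congr($(h3).hom (SymmetricAlgebra.lift θ a))
  have hx : IsUnit (((Scheme.ΓSpecIso (.of S)).hom.hom.comp
      ((Spec.map (CommRingCat.ofHom g.toRingHom)).appTop.hom.comp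
      ((Scheme.ΓSpecIso (.of A)).inv.hom.comp
      (SymmetricAlgebra.lift θ : CoordRing k W →ₐ[k] A).toRingHom)))
        (SymmetricAlgebra.ι k _ φ)) := by
    rw [key]; exact lift_ι_isUnit h
  rw [toProjectiveSpace, comp_fromOfGlobalSections _ _ _ _ (ι_mem_homogeneousPart_one φ) one_pos hx]
  simp only [key]
  rfl

theorem toProjectiveSpace_eq (θ : Module.Dual k W →ₗ[k] S)
    (hθ : Ideal.span (Set.range θ) = ⊤) (φ : Module.Dual k W)
    (h : IsUnit (θ φ)) :
    toProjectiveSpace θ hθ = Spec.map (CommRingCat.ofHom (chartEval θ φ h)) ≫ chart φ := by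
  have := comp_toProjectiveSpace θ hθ (AlgHom.id k S) φ h
  have h2 : Spec.map (CommRingCat.ofHom (AlgHom.id k S).toRingHom) = 𝟙 _ := Spec.map_id _
  rw [h2, Category.id_comp] at this
  exact this

theorem chart_opensRange (φ : Module.Dual k W) :
    (chart φ).opensRange = Proj.basicOpen (homogeneousPart k W) (SymmetricAlgebra.ι k _ φ) :=
  Proj.opensRange_awayι _ _ _ _

theorem toProjectiveSpace_preimage (θ : Module.Dual k W →ₗ[k] A)
    (hθ : Ideal.span (Set.range θ) = ⊤) (φ : Module.Dual k W) :
    toProjectiveSpace θ hθ ⁻¹ᵁ (chart φ).opensRange =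
      (PrimeSpectrum.basicOpen (θ φ) : (Spec (.of A)).Opens) := by
  rw [chart_opensRange, toProjectiveSpace,
    Proj.fromOfGlobalSections_preimage_basicOpen _ _ _ one_pos (ι_mem_homogeneousPart_one φ)]
  simp only [RingHom.comp_apply, AlgHom.toRingHom_eq_coe, RingHom.coe_coe,
    SymmetricAlgebra.lift_ι_apply]
  exact basicOpen_eq_of_affine (R := .of A) (θ φ)

end Charts

/-! ### Ideal sheaves on affine schemes -/

section IdealSheaves

variable {A B : Type u} [CommRing A] [CommRing B]

/-- The ideal of `A` that corresponds to an ideal sheaf on `Spec A`. -/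
def topIdeal (K : (Spec (.of A)).IdealSheafData) : Ideal A :=
  (K.ideal ⟨⊤, isAffineOpen_top _⟩).comap (Scheme.ΓSpecIso (.of A)).inv.hom

theorem topIdeal_ker {Z : Scheme.{u}} (f : Z ⟶ Spec (.of A)) :
    topIdeal f.ker = idealOfImage f := by
  rw [topIdeal, Scheme.ker_of_isAffine, Scheme.IdealSheafData.ofIdealTop_ideal]
  have : ((Spec (.of A)).presheaf.map (homOfLE (le_top : (⊤ : (Spec (.of A)).Opens) ≤ ⊤)).op).hom =
      RingHom.id _ := by
    have := (Spec (.of A)).presheaf.map_id (.op ⊤)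
    exact congr($(this).hom)
  erw [this, Ideal.map_id]
  rw [RingHom.comap_ker, idealOfImage, CommRingCat.hom_comp]

theorem topIdeal_le_iff {K K' : (Spec (.of A)).IdealSheafData} :
    topIdeal K ≤ topIdeal K' ↔ K ≤ K' := by
  refine ⟨fun h => Scheme.IdealSheafData.le_of_isAffine fun x hx => ?_,
    fun h => Ideal.comap_mono (h _)⟩
  have := @h ((Scheme.ΓSpecIso (.of A)).hom.hom x)
    (by rw [topIdeal, Ideal.mem_comap, Iso.hom_inv_id_apply]; exact hx)
  rwa [topIdeal, Ideal.mem_comap, Iso.hom_inv_id_apply] at this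

theorem idealOfImage_comp_specMap {Z : Scheme.{u}} (f : Z ⟶ Spec (.of B)) (φ : A →+* B) :
    idealOfImage (f ≫ Spec.map (CommRingCat.ofHom φ)) = (idealOfImage f).comap φ := by
  rw [idealOfImage, Scheme.Hom.comp_appTop, ← Category.assoc, ← Scheme.ΓSpecIso_inv_naturality,
    Category.assoc, CommRingCat.hom_comp, ← RingHom.comap_ker]
  rfl

theorem idealOfImage_specMap (φ : A →+* B) :
    idealOfImage (Spec.map (CommRingCat.ofHom φ)) = RingHom.ker φ := by
  rw [idealOfImage, ← Scheme.ΓSpecIso_inv_naturality, CommRingCat.hom_comp, ← RingHom.comap_ker]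
  ext a
  rw [Ideal.mem_comap, RingHom.mem_ker, RingHom.mem_ker, CommRingCat.hom_ofHom]
  exact map_eq_zero_iff _ (ConcreteCategory.bijective_of_isIso (Scheme.ΓSpecIso (.of B)).inv).1

theorem exists_topIdeal_eq (n : Ideal A) :
    ∃ K : (Spec (.of A)).IdealSheafData, topIdeal K = n :=
  ⟨(Spec.map (CommRingCat.ofHom (Ideal.Quotient.mk n))).ker, by
    rw [topIdeal_ker, idealOfImage_specMap, Ideal.mk_ker]⟩

/-- Scheme-theoretic images of closed subschemes of affine schemes, in terms of ideals. -/
theorem topIdeal_map (K : (Spec (.of B)).IdealSheafData) (φ : A →+* B) :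
    topIdeal (K.map (Spec.map (CommRingCat.ofHom φ))) = (topIdeal K).comap φ := by
  rw [Scheme.IdealSheafData.map, topIdeal_ker, idealOfImage_comp_specMap, ← topIdeal_ker,
    Scheme.IdealSheafData.ker_subschemeι]

/-- Preimages of closed subschemes of affine schemes, in terms of ideals; by adjunction, this
follows from the description of images. -/
theorem topIdeal_comap (K : (Spec (.of A)).IdealSheafData) (φ : A →+* B) :
    topIdeal (K.comap (Spec.map (CommRingCat.ofHom φ))) = (topIdeal K).map φ := by
  refine eq_of_forall_ge_iff fun n => ?_
  obtain ⟨N, rfl⟩ := exists_topIdeal_eq n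
  rw [topIdeal_le_iff, ← Scheme.IdealSheafData.le_map_iff_comap_le, ← topIdeal_le_iff,
    topIdeal_map, Ideal.map_le_iff_le_comap]

/-- A closed subscheme of a closed subscheme is the preimage of its image. -/
theorem comap_map_of_isClosedImmersion {X Y : Scheme.{u}} (c : X ⟶ Y) [IsClosedImmersion c]
    (N : X.IdealSheafData) : (N.map c).comap c = N := by
  rw [Scheme.IdealSheafData.map, ← Scheme.IdealSheafData.ker_fst_of_isClosedImmersion]
  have h : IsPullback N.subschemeι (𝟙 _) c (N.subschemeι ≫ c) := by
    have h1 : IsPullback N.subschemeι (𝟙 _) (𝟙 _) N.subschemeι := IsPullback.of_vert_isIso ⟨by simp⟩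
    simpa using h1.paste_horiz (IsKernelPair.id_of_mono c)
  rw [← Scheme.Hom.ker_comp_of_isIso h.isoPullback.hom, IsPullback.isoPullback_hom_fst,
    Scheme.IdealSheafData.ker_subschemeι]

/-- Scheme-theoretic images commute with restriction to open subschemes of the target. -/
theorem ker_comap_of_isOpenImmersion {X Y U V : Scheme.{u}} {f : X ⟶ Y} {f' : U ⟶ V} {iU : U ⟶ X}
    {iV : V ⟶ Y} [IsOpenImmersion iV] [QuasiCompact f] (h : IsPullback f' iU iV f) :
    f.ker.comap iV = f'.ker := by
  ext1; funext W
  rw [Scheme.IdealSheafData.ideal_comap_of_isOpenImmersion,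
    Scheme.ker_ideal_of_isPullback_of_isOpenImmersion f f' iU iV h]

end IdealSheaves

/-! ### Coordinate functions and linear coordinates -/

section ChartFunctions

variable {k W : Type u} [Field k] [AddCommGroup W] [Module k W]
variable {S : Type u} [CommRing S] [Algebra k S]

theorem chartEval_mk (θ : Module.Dual k W →ₗ[k] S) {φ : Module.Dual k W} (h : IsUnit (θ φ))
    (n : ℕ) (a : CoordRing k W) (ha : a ∈ homogeneousPart k W (n • 1)) :
    chartEval θ φ h (HomogeneousLocalization.Away.mk _ (ι_mem_homogeneousPart_one φ) n a ha) *
      θ φ ^ n = SymmetricAlgebra.lift θ a := by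
  have := awayEval_mk (homogeneousPart k W)
    (SymmetricAlgebra.lift θ : CoordRing k W →ₐ[k] S).toRingHom (lift_ι_isUnit h)
    (ι_mem_homogeneousPart_one φ) n a ha
  simpa [chartEval] using this

theorem lift_smul_of_mem_homogeneousPart (θ : Module.Dual k W →ₗ[k] S) (s : S) {n : ℕ}
    {a : CoordRing k W} (ha : a ∈ homogeneousPart k W n) :
    SymmetricAlgebra.lift (LinearMap.mulLeft k s ∘ₗ θ) a = s ^ n * SymmetricAlgebra.lift θ a := by
  induction ha using Submodule.pow_induction_on_left' with
  | algebraMap r => simp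
  | add x y i hx hy ihx ihy => rw [map_add, ihx, ihy, map_add, mul_add]
  | mem_mul m hm i x hx ih =>
    obtain ⟨ψ, rfl⟩ := hm
    rw [map_mul, ih, map_mul, SymmetricAlgebra.lift_ι_apply, SymmetricAlgebra.lift_ι_apply]
    simp only [LinearMap.comp_apply, LinearMap.mulLeft_apply, Nat.succ_eq_add_one]
    ring

/-- Proportional families of vectors define the same point of projective space. -/
theorem chartEval_congr {θ θ' : Module.Dual k W →ₗ[k] S} {φ : Module.Dual k W} (h : IsUnit (θ φ))
    (h' : IsUnit (θ' φ)) (s : S) (hs : ∀ ψ, θ' ψ = s * θ ψ) :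
    chartEval θ φ h = chartEval θ' φ h' := by
  ext x
  obtain ⟨n, a, ha, rfl⟩ := HomogeneousLocalization.Away.mk_surjective _
    (ι_mem_homogeneousPart_one φ) x
  apply (h'.pow n).mul_right_cancel
  rw [chartEval_mk, hs, mul_pow, mul_left_comm, chartEval_mk]
  have : θ' = LinearMap.mulLeft k s ∘ₗ θ := by ext ψ; simp [hs]
  rw [this, lift_smul_of_mem_homogeneousPart (n := n) θ s (by simpa using ha)]

theorem exists_chartEval_eq (θ : Module.Dual k W →ₗ[k] S) {φ : Module.Dual k W}
    (h : θ φ = 1) (hu : IsUnit (θ φ)) (ψ : Module.Dual k W) :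
    ∃ b, chartEval θ φ hu b = θ ψ := by
  refine ⟨HomogeneousLocalization.Away.mk _ (ι_mem_homogeneousPart_one φ) 1
    (SymmetricAlgebra.ι k _ ψ) (by simp), ?_⟩
  have := chartEval_mk θ (φ := φ) hu 1
    (SymmetricAlgebra.ι k _ ψ) (by simp)
  rwa [h, one_pow, mul_one, SymmetricAlgebra.lift_ι_apply] at this

theorem exists_chartEval_eq_algebraMap (θ : Module.Dual k W →ₗ[k] S) {φ : Module.Dual k W}
    (hu : IsUnit (θ φ)) (r : k) :
    ∃ b, chartEval θ φ hu b = algebraMap k S r := by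
  have hr : algebraMap k (CoordRing k W) r ∈ homogeneousPart k W (0 • 1) := by
    rw [zero_smul]; exact SetLike.algebraMap_mem_graded _ r
  refine ⟨HomogeneousLocalization.Away.mk _ (ι_mem_homogeneousPart_one φ) 0 _ hr, ?_⟩
  have := chartEval_mk θ (φ := φ) hu 0 _ hr
  rwa [pow_zero, mul_one, AlgHom.commutes] at this

theorem inclusionCoords_snd : inclusionCoords k W (LinearMap.snd k W k) = 1 := by
  have h : (LinearMap.inl k W k).dualMap (LinearMap.snd k W k) = 0 := by ext; simp
  change SymmetricAlgebra.ι k (Module.Dual k W)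
      ((LinearMap.inl k W k).dualMap (LinearMap.snd k W k)) +
    algebraMap k (CoordRing k W) 1 = 1
  rw [h, map_zero, zero_add, map_one]

theorem isUnit_inclusionCoords_snd : IsUnit (inclusionCoords k W (LinearMap.snd k W k)) := by
  rw [inclusionCoords_snd]; exact isUnit_one

theorem inclusionCoords_comp_fst (ψ : Module.Dual k W) :
    inclusionCoords k W (ψ ∘ₗ LinearMap.fst k W k) = SymmetricAlgebra.ι k _ ψ := by
  have h : (LinearMap.inl k W k).dualMap (ψ ∘ₗ LinearMap.fst k W k) = ψ := by ext; simp
  simp [inclusionCoords, h]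

theorem chartEval_inclusionCoords_surjective : Function.Surjective
    (chartEval (inclusionCoords k W) (LinearMap.snd k W k) isUnit_inclusionCoords_snd) := by
  intro r
  rw [← RingHom.mem_range]
  induction r using SymmetricAlgebra.induction with
  | algebraMap r => exact exists_chartEval_eq_algebraMap _ isUnit_inclusionCoords_snd r
  | ι ψ =>
    have := exists_chartEval_eq _ inclusionCoords_snd isUnit_inclusionCoords_snd
      (ψ ∘ₗ LinearMap.fst k W k)
    rwa [inclusionCoords_comp_fst] at this
  | mul a b ha hb => exact mul_mem ha hb
  | add a b ha hb => exact add_mem ha hb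

theorem inclusion_eq : inclusion k W = Spec.map (CommRingCat.ofHom
    (chartEval (inclusionCoords k W) (LinearMap.snd k W k) isUnit_inclusionCoords_snd)) ≫
      chart (LinearMap.snd k W k) :=
  toProjectiveSpace_eq _ _ _ _

end ChartFunctions

section Coordinates

variable {k V : Type u} [Field k] [AddCommGroup V] [Module k V] {L H : Submodule k V}

theorem pullbackHom_ι {W : Type u} [AddCommGroup W] [Module k W] (f : V →ₗ[k] W)
    (φ : Module.Dual k W) :
    pullbackHom f (SymmetricAlgebra.ι k _ φ) = SymmetricAlgebra.ι k (Module.Dual k V) (φ ∘ₗ f) := by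
  rw [pullbackHom, SymmetricAlgebra.lift_ι_apply]; rfl

/-- The section of `V → V / L` with image `H`. -/
def quotientSection (hLH : IsCompl L H) : (V ⧸ L) →ₗ[k] V :=
  H.subtype ∘ₗ (L.quotientEquivOfIsCompl H hLH).toLinearMap

theorem mkQ_comp_quotientSection (hLH : IsCompl L H) :
    L.mkQ ∘ₗ quotientSection hLH = LinearMap.id := by
  ext v
  have := (L.quotientEquivOfIsCompl H hLH).symm_apply_apply (L.mkQ v)
  rw [Submodule.quotientEquivOfIsCompl_symm_apply] at this
  exact this

/-- The linear form `ℓ` on `V` vanishes on `H` and takes the value one at the chosen vector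
of `L`. -/
structure IsLineCoord (hL : Module.finrank k L = 1) (H : Submodule k V) (ℓ : Module.Dual k V) :
    Prop where
  apply_spanningVector : ℓ (spanningVector L hL) = 1
  apply_of_mem : ∀ h ∈ H, ℓ h = 0

theorem exists_isLineCoord (hL : Module.finrank k L = 1) (hLH : IsCompl L H) :
    ∃ ℓ, IsLineCoord hL H ℓ := by
  obtain ⟨φ, hφ⟩ := Module.Projective.exists_dual_ne_zero k (spanningVector_ne_zero L hL)
  refine ⟨(φ (spanningVector L hL))⁻¹ • φ ∘ₗ L.projection H hLH, ?_, fun h hh => ?_⟩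
  · have : L.projection H hLH (spanningVector L hL) = spanningVector L hL :=
      Submodule.projection_apply_of_mem_left hLH (spanningVector_mem L hL)
    simp [this, hφ]
  · have : L.projection H hLH h = 0 := Submodule.projection_apply_of_mem_right hLH hh
    simp [this]

variable {hL : Module.finrank k L = 1} {ℓ : Module.Dual k V}

theorem IsLineCoord.smul_spanningVector (hℓ : IsLineCoord hL H ℓ) {v : V} (hv : v ∈ L) :
    ℓ v • spanningVector L hL = v := by
  obtain ⟨c, rfl⟩ := (finrank_eq_one_iff_of_nonzero' (⟨_, spanningVector_mem L hL⟩ : L)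
    (by simpa using spanningVector_ne_zero L hL)).1 hL ⟨v, hv⟩ |>.imp
      fun c hc => congrArg Subtype.val hc.symm
  simp [hℓ.apply_spanningVector]

theorem IsLineCoord.decomposition (hℓ : IsLineCoord hL H ℓ) (hLH : IsCompl L H) (v : V) :
    v = quotientSection hLH (L.mkQ v) + ℓ v • spanningVector L hL := by
  have h1 : v - quotientSection hLH (L.mkQ v) ∈ L := by
    rw [← Submodule.Quotient.mk_eq_zero, ← Submodule.mkQ_apply, map_sub]
    have := congr($(mkQ_comp_quotientSection hLH) (L.mkQ v))
    simp only [LinearMap.comp_apply, LinearMap.id_apply] at this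
    rw [this, sub_self]
  have h2 : ℓ (quotientSection hLH (L.mkQ v)) = 0 := hℓ.apply_of_mem _ (Subtype.mem _)
  have h3 := hℓ.smul_spanningVector h1
  rw [map_sub, h2, sub_zero] at h3
  rw [h3]; abel

theorem IsLineCoord.comp_quotientSection (hℓ : IsLineCoord hL H ℓ) (hLH : IsCompl L H) :
    ℓ ∘ₗ quotientSection hLH = 0 := by
  ext v; exact hℓ.apply_of_mem _ (Subtype.mem _)

theorem IsLineCoord.dual_decomposition (hℓ : IsLineCoord hL H ℓ) (hLH : IsCompl L H)
    (φ : Module.Dual k V) :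
    φ = (φ ∘ₗ quotientSection hLH) ∘ₗ L.mkQ + φ (spanningVector L hL) • ℓ := by
  ext v
  conv_lhs => rw [hℓ.decomposition hLH v]
  simp [mul_comm]

end Coordinates

/-! ### The chart of the blow-up at infinity -/

section

variable {k V : Type u} [Field k] [AddCommGroup V] [Module k V] {L H : Submodule k V}
  (hL : Module.finrank k L = 1) (hLH : IsCompl L H)

/-- The coordinates of the vector `(u h + l, u)` of `V ⊕ k`, for `h` the generic point of
`H ≅ V / L`, for `l` the chosen vector of `L`, and for `u` the coordinate of the affine line. -/
def infinityCoords : Module.Dual k (V × k) →ₗ[k] Polynomial (CoordRing k (V ⧸ L)) :=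
  LinearMap.mulLeft k Polynomial.X ∘ₗ Polynomial.CAlgHom.toLinearMap ∘ₗ
      inclusionCoords k (V ⧸ L) ∘ₗ ((quotientSection hLH).prodMap LinearMap.id).dualMap +
    Algebra.linearMap k _ ∘ₗ Module.Dual.eval k (V × k) (spanningVector L hL, 0)

theorem infinityCoords_apply (ψ : Module.Dual k (V × k)) :
    infinityCoords hL hLH ψ = Polynomial.X * Polynomial.C (inclusionCoords k (V ⧸ L)
      (ψ ∘ₗ (quotientSection hLH).prodMap LinearMap.id)) +
        algebraMap k _ (ψ (spanningVector L hL, 0)) := rfl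

variable {hL} {ℓ : Module.Dual k V} (hℓ : IsLineCoord hL H ℓ)

include hℓ in
theorem infinityCoords_line : infinityCoords hL hLH (ℓ ∘ₗ LinearMap.fst k V k) = 1 := by
  have h : (ℓ ∘ₗ LinearMap.fst k V k) ∘ₗ (quotientSection hLH).prodMap LinearMap.id = 0 := by
    ext v
    · exact congr($(hℓ.comp_quotientSection hLH) _)
    · simp
  rw [infinityCoords_apply, h, map_zero, map_zero, mul_zero, zero_add]
  simp [hℓ.apply_spanningVector]

theorem infinityCoords_snd : infinityCoords hL hLH (LinearMap.snd k V k) = Polynomial.X := by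
  have h : LinearMap.snd k V k ∘ₗ (quotientSection hLH).prodMap LinearMap.id =
      LinearMap.snd k (V ⧸ L) k := by ext v <;> simp
  rw [infinityCoords_apply, h, inclusionCoords_snd]
  simp

include hℓ in
theorem isUnit_infinityCoords_line :
    IsUnit (infinityCoords hL hLH (ℓ ∘ₗ LinearMap.fst k V k)) := by
  rw [infinityCoords_line hLH hℓ]; exact isUnit_one

include hℓ in
theorem span_range_infinityCoords : Ideal.span (Set.range (infinityCoords hL hLH)) = ⊤ :=
  Ideal.eq_top_of_isUnit_mem _ (Ideal.subset_span ⟨_, rfl⟩) (isUnit_infinityCoords_line hLH hℓ)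

theorem inclusionCoords_apply (W : Type u) [AddCommGroup W] [Module k W]
    (ψ : Module.Dual k (W × k)) :
    inclusionCoords k W ψ = SymmetricAlgebra.ι k (Module.Dual k W) (ψ ∘ₗ LinearMap.inl k W k) +
      algebraMap k _ (ψ (0, 1)) := rfl

/-- For an `S`-valued point `p` of `V`, the `S`-valued point of `V / L × A¹` with the image of `p`
as first component and the coordinate `u = y`; here `y` is meant to be the inverse of the value of
`ℓ` at `p`. -/
def invertLine {S : Type u} [CommRing S] [Algebra k S] (L : Submodule k V)
    (p : CoordRing k V →ₐ[k] S) (y : S) :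
    Polynomial (CoordRing k (V ⧸ L)) →ₐ[k] S :=
  Polynomial.aevalTower (p.comp (pullbackHom L.mkQ)) y

include hℓ in
/-- The vectors `(v, 1)` and `(u h + l, u)` are proportional for `u⁻¹ = ℓ v`. -/
theorem inclusionCoords_eq_mul_infinityCoords {S : Type u} [CommRing S] [Algebra k S]
    (p : CoordRing k V →ₐ[k] S) {y : S} (hy : p (SymmetricAlgebra.ι k _ ℓ) * y = 1)
    (ψ : Module.Dual k (V × k)) :
    p (inclusionCoords k V ψ) =
      p (SymmetricAlgebra.ι k _ ℓ) * invertLine L p y (infinityCoords hL hLH ψ) := by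
  have h1 : invertLine L p y (infinityCoords hL hLH ψ) =
      y * p (pullbackHom L.mkQ (inclusionCoords k (V ⧸ L)
        (ψ ∘ₗ (quotientSection hLH).prodMap LinearMap.id))) +
        algebraMap k S (ψ (spanningVector L hL, 0)) := by
    rw [infinityCoords_apply, map_add, map_mul, AlgHom.commutes, invertLine,
      Polynomial.aevalTower_X, Polynomial.aevalTower_C, AlgHom.comp_apply]
  rw [h1, mul_add, ← mul_assoc, hy, one_mul, inclusionCoords_apply, inclusionCoords_apply,
    map_add, map_add, map_add, AlgHom.commutes, AlgHom.commutes, AlgHom.commutes, pullbackHom_ι]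
  conv_lhs => rw [hℓ.dual_decomposition hLH (ψ ∘ₗ LinearMap.inl k V k), map_add, map_smul, map_add,
    map_smul]
  have h2 : (ψ ∘ₗ (quotientSection hLH).prodMap LinearMap.id) ∘ₗ LinearMap.inl k (V ⧸ L) k =
      (ψ ∘ₗ LinearMap.inl k V k) ∘ₗ quotientSection hLH := by ext; simp
  rw [h2, Algebra.smul_def]
  simp only [LinearMap.comp_apply, LinearMap.prodMap_apply, map_zero, LinearMap.id_apply,
    LinearMap.inl_apply]
  ring

/-- The chart of the blow-up that contains the copy of `V / L` in the exceptional divisor: the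
product of `V / L` and the affine line, mapped to the product of the projective completions. -/
def infinityChart : Spec (.of (Polynomial (CoordRing k (V ⧸ L)))) ⟶ completionProduct L :=
  pullback.lift (toProjectiveSpace (infinityCoords hL hLH) (span_range_infinityCoords hLH hℓ))
    (Spec.map (CommRingCat.ofHom Polynomial.C) ≫ inclusion k (V ⧸ L)) (by
      rw [Category.assoc, inclusion, toProjectiveSpace_toSpec, toProjectiveSpace_toSpec,
        ← Spec.map_comp]
      rfl)

/-- Where `ℓ` is invertible, the graph lies in the chart at infinity, and is there given by
`v ↦ (v mod L, u = (ℓ v)⁻¹)`. -/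
theorem specMap_comp_graph {S : Type u} [CommRing S] [Algebra k S]
    (p : CoordRing k V →ₐ[k] S) {y : S} (hy : p (SymmetricAlgebra.ι k _ ℓ) * y = 1) :
    Spec.map (CommRingCat.ofHom p.toRingHom) ≫ graph L =
      Spec.map (CommRingCat.ofHom (invertLine L p y).toRingHom) ≫ infinityChart hLH hℓ := by
  have hp : IsUnit (p (SymmetricAlgebra.ι k _ ℓ)) := IsUnit.of_mul_eq_one _ hy
  refine pullback.hom_ext ?_ ?_
  · have h1 : IsUnit (p (inclusionCoords k V (ℓ ∘ₗ LinearMap.fst k V k))) := by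
      rwa [inclusionCoords_comp_fst]
    have h2 : IsUnit (invertLine L p y (infinityCoords hL hLH (ℓ ∘ₗ LinearMap.fst k V k))) :=
      (isUnit_infinityCoords_line hLH hℓ).map _
    rw [Category.assoc, Category.assoc, infinityChart, graph, pullback.lift_fst, pullback.lift_fst,
      inclusion, comp_toProjectiveSpace _ _ p _ h1, comp_toProjectiveSpace _ _ _ _ h2]
    congr 3
    exact (chartEval_congr _ _ (p (SymmetricAlgebra.ι k _ ℓ))
      (inclusionCoords_eq_mul_infinityCoords hLH hℓ p hy)).symm
  · rw [Category.assoc, Category.assoc, infinityChart, graph, pullback.lift_snd, pullback.lift_snd,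
      quotientMap, ← Spec.map_comp_assoc, ← Spec.map_comp_assoc, ← CommRingCat.ofHom_comp,
      ← CommRingCat.ofHom_comp]
    congr 3
    exact (Polynomial.aevalTower_comp_C (p.comp (pullbackHom L.mkQ)) y).symm

end

/-! ### The closure of a subscheme in the chart at infinity -/

section Functions

variable {k V : Type u} [Field k] [AddCommGroup V] [Module k V] {L : Submodule k V}
  (ℓ : Module.Dual k V)

/-- The affine chart of the product of projective completions on which the linear form `ℓ` on `V`
and the last coordinate of `V / L ⊕ k` do not vanish. -/
abbrev productChart (L : Submodule k V) (ℓ : Module.Dual k V) : Scheme.{u} :=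
  pullback (chart (ℓ ∘ₗ LinearMap.fst k V k) ≫ projectiveSpaceToSpec k (V × k))
    (chart (LinearMap.snd k (V ⧸ L) k) ≫ projectiveSpaceToSpec k ((V ⧸ L) × k))

instance isAffine_productChart : IsAffine (productChart L ℓ) := by
  unfold productChart
  infer_instance

/-- The inclusion of the affine chart in the product of projective completions. -/
def productChartι (L : Submodule k V) (ℓ : Module.Dual k V) :
    productChart L ℓ ⟶ completionProduct L :=
  pullback.map _ _ _ _ (chart _) (chart _) (𝟙 _) (Category.comp_id _) (Category.comp_id _)

instance isOpenImmersion_productChartι : IsOpenImmersion (productChartι L ℓ) := by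
  unfold productChartι; infer_instance

theorem productChartι_opensRange : (productChartι L ℓ).opensRange =
    pullback.fst (projectiveSpaceToSpec k (V × k)) (projectiveSpaceToSpec k ((V ⧸ L) × k)) ⁻¹ᵁ
        (chart (ℓ ∘ₗ LinearMap.fst k V k)).opensRange ⊓
      pullback.snd (projectiveSpaceToSpec k (V × k)) (projectiveSpaceToSpec k ((V ⧸ L) × k)) ⁻¹ᵁ
        (chart (LinearMap.snd k (V ⧸ L) k)).opensRange := by
  ext1
  exact Scheme.Pullback.range_map _ _ _ _ _ _ (𝟙 _) (Category.comp_id _) (Category.comp_id _)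

variable {hL : Module.finrank k L = 1} {H : Submodule k V} (hLH : IsCompl L H)
variable {ℓ} (hℓ : IsLineCoord hL H ℓ)

/-- The chart `V / L × A¹` at infinity, mapped to the affine chart of the product. -/
def infinityChartLift : Spec (.of (Polynomial (CoordRing k (V ⧸ L)))) ⟶ productChart L ℓ :=
  pullback.lift
    (Spec.map (CommRingCat.ofHom (chartEval (infinityCoords hL hLH) (ℓ ∘ₗ LinearMap.fst k V k)
      (isUnit_infinityCoords_line hLH hℓ))))
    (Spec.map (CommRingCat.ofHom Polynomial.C) ≫ Spec.map (CommRingCat.ofHom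
      (chartEval (inclusionCoords k (V ⧸ L)) (LinearMap.snd k (V ⧸ L) k)
        isUnit_inclusionCoords_snd))) (by
      have := (infinityChart hLH hℓ ≫= pullback.condition)
      simp only [infinityChart, pullback.lift_fst_assoc, pullback.lift_snd_assoc] at this
      rw [toProjectiveSpace_eq _ _ _ (isUnit_infinityCoords_line hLH hℓ), inclusion_eq] at this
      simpa using this)

theorem infinityChartLift_comp : infinityChartLift hLH hℓ ≫ productChartι L ℓ =
    infinityChart hLH hℓ := by
  refine pullback.hom_ext ?_ ?_
  · rw [infinityChart, pullback.lift_fst, toProjectiveSpace_eq _ _ _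
      (isUnit_infinityCoords_line hLH hℓ), infinityChartLift, productChartι, Category.assoc,
      pullback.lift_fst, pullback.lift_fst_assoc]
  · rw [infinityChart, pullback.lift_snd, inclusion_eq, infinityChartLift, productChartι,
      Category.assoc, pullback.lift_snd, pullback.lift_snd_assoc, Category.assoc]

theorem mem_range_appTop_of_comp_eq {R S : Type u} [CommRing R] [CommRing S] {Y : Scheme.{u}}
    (c : Spec (.of S) ⟶ Y) (q : Y ⟶ Spec (.of R)) (f : R →+* S)
    (h : c ≫ q = Spec.map (CommRingCat.ofHom f)) (r : R) :
    f r ∈ ((Scheme.ΓSpecIso (.of S)).hom.hom.comp c.appTop.hom).range := by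
  refine ⟨q.appTop.hom ((Scheme.ΓSpecIso (.of R)).inv.hom r), ?_⟩
  have h1 : q.appTop ≫ c.appTop = (Spec.map (CommRingCat.ofHom f)).appTop := by
    rw [← Scheme.Hom.comp_appTop, h]
  have h2 := Scheme.ΓSpecIso_inv_naturality (CommRingCat.ofHom f)
  have h3 : (Scheme.ΓSpecIso (.of R)).inv ≫ q.appTop ≫ c.appTop ≫ (Scheme.ΓSpecIso (.of S)).hom =
      CommRingCat.ofHom f := by
    rw [reassoc_of% h1, ← reassoc_of% h2, Iso.inv_hom_id, Category.comp_id]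
  exact congr($(h3).hom r)

instance isClosedImmersion_infinityChartLift : IsClosedImmersion (infinityChartLift hLH hℓ) := by
  apply IsClosedImmersion.of_surjective_of_isAffine
  set G := (Scheme.ΓSpecIso (.of (Polynomial (CoordRing k (V ⧸ L))))).hom.hom.comp
    (infinityChartLift hLH hℓ).appTop.hom with hG
  have hC (r : CoordRing k (V ⧸ L)) : Polynomial.C r ∈ G.range := by
    obtain ⟨b, rfl⟩ := chartEval_inclusionCoords_surjective r
    refine mem_range_appTop_of_comp_eq (infinityChartLift hLH hℓ) (pullback.snd _ _)
      (Polynomial.C.comp (chartEval (inclusionCoords k (V ⧸ L)) (LinearMap.snd k (V ⧸ L) k)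
        isUnit_inclusionCoords_snd)) ?_ b
    rw [infinityChartLift, pullback.lift_snd, ← Spec.map_comp]
    rfl
  have hX : Polynomial.X ∈ G.range := by
    obtain ⟨b, hb⟩ := exists_chartEval_eq (infinityCoords hL hLH) (infinityCoords_line hLH hℓ)
      (isUnit_infinityCoords_line hLH hℓ) (LinearMap.snd k V k)
    rw [infinityCoords_snd] at hb
    rw [← hb]
    refine mem_range_appTop_of_comp_eq (infinityChartLift hLH hℓ) (pullback.fst _ _) _ ?_ b
    rw [infinityChartLift, pullback.lift_fst]
  have hs : Function.Surjective G := by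
    intro p
    rw [← RingHom.mem_range]
    induction p using Polynomial.induction_on' with
    | add p q hp hq => exact add_mem hp hq
    | monomial n r =>
      rw [← Polynomial.C_mul_X_pow_eq_monomial]
      exact mul_mem (hC r) (pow_mem hX n)
  intro x
  obtain ⟨y, hy⟩ := hs ((Scheme.ΓSpecIso _).hom.hom x)
  refine ⟨y, (ConcreteCategory.bijective_of_isIso (Scheme.ΓSpecIso _).hom).1 hy⟩

end Functions

section Closure

variable {k V : Type u} [Field k] [AddCommGroup V] [Module k V] {L : Submodule k V}
  {hL : Module.finrank k L = 1} {H : Submodule k V} (hLH : IsCompl L H)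
  {ℓ : Module.Dual k V} (hℓ : IsLineCoord hL H ℓ) (I : Ideal (CoordRing k V))

/-- The closed subscheme `X`, mapped to the product of the projective completions. -/
def subschemeToProduct (L : Submodule k V) (I : Ideal (CoordRing k V)) :
    Spec (.of (CoordRing k V ⧸ I)) ⟶ completionProduct L :=
  Spec.map (CommRingCat.ofHom (Ideal.Quotient.mk I)) ≫ graph L

/-- The ring of functions on the open subscheme of `X` on which `ℓ` is invertible. -/
abbrev AwayQuotient (I : Ideal (CoordRing k V)) (ℓ : Module.Dual k V) : Type u :=
  Localization.Away (Ideal.Quotient.mk I (SymmetricAlgebra.ι k _ ℓ))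

/-- Restriction of functions on `V` to the open subscheme of `X` on which `ℓ` is invertible. -/
def toAwayQuotient (I : Ideal (CoordRing k V)) (ℓ : Module.Dual k V) :
    CoordRing k V →ₐ[k] AwayQuotient I ℓ :=
  (IsScalarTower.toAlgHom k (CoordRing k V ⧸ I) (AwayQuotient I ℓ)).comp (Ideal.Quotient.mkₐ k I)

/-- The inverse of `ℓ`. -/
def lineInv (I : Ideal (CoordRing k V)) (ℓ : Module.Dual k V) : AwayQuotient I ℓ :=
  IsLocalization.Away.invSelf (Ideal.Quotient.mk I (SymmetricAlgebra.ι k _ ℓ))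

theorem toAwayQuotient_mul_lineInv :
    toAwayQuotient I ℓ (SymmetricAlgebra.ι k _ ℓ) * lineInv I ℓ = 1 :=
  IsLocalization.Away.mul_invSelf (Ideal.Quotient.mk I (SymmetricAlgebra.ι k _ ℓ))

/-- The functions on the chart at infinity, restricted to the open subscheme of `X` on which `ℓ` is
invertible. -/
abbrev infinityRestriction (L : Submodule k V) (I : Ideal (CoordRing k V)) (ℓ : Module.Dual k V) :
    Polynomial (CoordRing k (V ⧸ L)) →ₐ[k] AwayQuotient I ℓ :=
  invertLine L (toAwayQuotient I ℓ) (lineInv I ℓ)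

/-- The preimage in `X` of the affine chart of the product is the open subscheme `ℓ ≠ 0`, and it
maps to the chart `V / L × A¹` at infinity. -/
theorem isPullback_subschemeToProduct :
    IsPullback
      (Spec.map (CommRingCat.ofHom (infinityRestriction L I ℓ).toRingHom) ≫
        infinityChartLift hLH hℓ)
      (Spec.map (CommRingCat.ofHom (algebraMap (CoordRing k V ⧸ I) (AwayQuotient I ℓ))))
      (productChartι L ℓ) (subschemeToProduct L I) := by
  have h1 : Spec.map (CommRingCat.ofHom (algebraMap (CoordRing k V ⧸ I) (AwayQuotient I ℓ))) ≫
      Spec.map (CommRingCat.ofHom (Ideal.Quotient.mk I)) =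
      Spec.map (CommRingCat.ofHom (toAwayQuotient I ℓ).toRingHom) := by
    rw [← Spec.map_comp]; rfl
  refine IsOpenImmersion.isPullback _ _ _ _ ?_ ?_
  · rw [subschemeToProduct, reassoc_of% h1, specMap_comp_graph hLH hℓ _
      (toAwayQuotient_mul_lineInv I), Category.assoc, infinityChartLift_comp]
  · rw [productChartι_opensRange, Scheme.Hom.preimage_inf, ← Scheme.Hom.comp_preimage,
      ← Scheme.Hom.comp_preimage]
    have h2 : subschemeToProduct L I ≫ pullback.fst _ _ =
        Spec.map (CommRingCat.ofHom (Ideal.Quotient.mk I)) ≫ inclusion k V := by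
      rw [subschemeToProduct, Category.assoc, graph, pullback.lift_fst]
    have h3 : subschemeToProduct L I ≫ pullback.snd _ _ =
        (Spec.map (CommRingCat.ofHom (Ideal.Quotient.mk I)) ≫ quotientMap L) ≫
          inclusion k (V ⧸ L) := by
      rw [subschemeToProduct, Category.assoc, graph, pullback.lift_snd, Category.assoc]
    rw [h2, h3, Scheme.Hom.comp_preimage, Scheme.Hom.comp_preimage, inclusion, inclusion,
      toProjectiveSpace_preimage, toProjectiveSpace_preimage, inclusionCoords_comp_fst,
      inclusionCoords_snd, PrimeSpectrum.basicOpen_one]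
    ext1
    refine Eq.trans ?_ (PrimeSpectrum.localization_away_comap_range (AwayQuotient I ℓ)
      (Ideal.Quotient.mk I (SymmetricAlgebra.ι k _ ℓ))).symm
    ext x
    exact and_iff_left trivial

instance isSeparated_projectiveSpaceToSpec (W : Type u) [AddCommGroup W] [Module k W] :
    IsSeparated (projectiveSpaceToSpec k W) := by
  unfold projectiveSpaceToSpec; infer_instance

instance quasiCompact_subschemeToProduct : QuasiCompact (subschemeToProduct L I) := by
  have : QuasiCompact (subschemeToProduct L I ≫ pullback.fst _ _ ≫
      projectiveSpaceToSpec k (V × k)) :=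
    quasiCompact_of_compactSpace _
  exact QuasiCompact.of_comp _ (pullback.fst _ _ ≫ projectiveSpaceToSpec k (V × k))

/-- In the chart `V / L × A¹` at infinity, the closure of `X` is the closure of the open subscheme
`ℓ ≠ 0` of `X`. -/
theorem ker_subschemeToProduct_comap :
    (subschemeToProduct L I).ker.comap (infinityChart hLH hℓ) =
      (Spec.map (CommRingCat.ofHom (infinityRestriction L I ℓ).toRingHom)).ker := by
  rw [← infinityChartLift_comp, Scheme.IdealSheafData.comap_comp,
    ker_comap_of_isOpenImmersion (isPullback_subschemeToProduct hLH hℓ I), Scheme.Hom.ker_comp,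
    comap_map_of_isClosedImmersion]

end Closure

/-! ### The intersection with the exceptional divisor -/

section Infinity

variable {k V : Type u} [Field k] [AddCommGroup V] [Module k V] (L : Submodule k V)
  (hL : Module.finrank k L = 1)

theorem center_toSpec : center L hL ≫ projectiveSpaceToSpec k (V × k) = 𝟙 _ := by
  rw [center, toProjectiveSpace_toSpec]
  exact Spec.map_id _

/-- The embedding of `V / L` in the product of the projective completions, as the open part of the
fibre over the point `P(L)`. -/
def quotientAtInfinity : affineSpace k (V ⧸ L) ⟶ completionProduct L :=
  pullback.lift
    (Spec.map (CommRingCat.ofHom (algebraMap k (CoordRing k (V ⧸ L)))) ≫ center L hL)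
    (inclusion k (V ⧸ L)) (by
      rw [Category.assoc, center_toSpec, inclusion, toProjectiveSpace_toSpec, Category.comp_id])

theorem quotientAtInfinity_fst : quotientAtInfinity L hL ≫ pullback.fst _ _ =
    Spec.map (CommRingCat.ofHom (algebraMap k (CoordRing k (V ⧸ L)))) ≫ center L hL :=
  pullback.lift_fst _ _ _

theorem quotientAtInfinity_snd : quotientAtInfinity L hL ≫ pullback.snd _ _ =
    inclusion k (V ⧸ L) :=
  pullback.lift_snd _ _ _

theorem exceptionalChart_w : exceptionalChartToQuotient L hL ≫ quotientAtInfinity L hL =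
    exceptionalChartToBlowUp L hL ≫ (graph L).imageι := by
  have h1 : pullback.fst (blowDown L) (center L hL) ≫ (graph L).imageι ≫ pullback.fst _ _ =
      pullback.snd _ _ ≫ center L hL := pullback.condition
  have h2 : pullback.fst (exceptionalDivisorToCompletion L hL) (inclusion k (V ⧸ L)) ≫
      (pullback.fst (blowDown L) (center L hL) ≫ (graph L).imageι ≫ pullback.snd _ _) =
      pullback.snd _ _ ≫ inclusion k (V ⧸ L) := pullback.condition
  refine pullback.hom_ext ?_ ?_
  · have h3 : pullback.snd (exceptionalDivisorToCompletion L hL) (inclusion k (V ⧸ L)) ≫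
        Spec.map (CommRingCat.ofHom (algebraMap k (CoordRing k (V ⧸ L)))) =
        pullback.fst _ _ ≫ pullback.snd (blowDown L) (center L hL) := by
      have h4 := h2 =≫ projectiveSpaceToSpec k ((V ⧸ L) × k)
      rw [Category.assoc, Category.assoc, Category.assoc, ← pullback.condition,
        Category.assoc, reassoc_of% h1, center_toSpec, Category.comp_id, inclusion,
        toProjectiveSpace_toSpec] at h4
      exact h4.symm
    rw [quotientAtInfinity, exceptionalChartToQuotient, exceptionalChartToBlowUp, Category.assoc,
      Category.assoc, pullback.lift_fst, Category.assoc, h1, reassoc_of% h3]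
  · rw [quotientAtInfinity, exceptionalChartToQuotient, exceptionalChartToBlowUp, Category.assoc,
      Category.assoc, pullback.lift_snd, Category.assoc, h2]

/-- The copy of `V / L` in the exceptional divisor is the intersection, in the product of the
projective completions, of the blow-up with `{P(L)} × V / L`. -/
theorem isPullback_exceptionalChart :
    IsPullback (exceptionalChartToQuotient L hL) (exceptionalChartToBlowUp L hL)
      (quotientAtInfinity L hL) (graph L).imageι := by
  have : Mono (center L hL) := mono_of_mono_fac (center_toSpec L hL)
  refine ⟨⟨exceptionalChart_w L hL⟩, ⟨PullbackCone.IsLimit.mk _ (fun s => pullback.lift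
    (pullback.lift s.snd
      (s.fst ≫ Spec.map (CommRingCat.ofHom (algebraMap k (CoordRing k (V ⧸ L))))) ?_) s.fst ?_)
    ?_ ?_ ?_⟩⟩
  · have := s.condition =≫ pullback.fst _ _
    rw [Category.assoc, quotientAtInfinity_fst, Category.assoc] at this
    rw [Category.assoc, this]
    rfl
  · have := s.condition =≫ pullback.snd _ _
    rw [Category.assoc, quotientAtInfinity_snd, Category.assoc] at this
    rw [this, exceptionalDivisorToCompletion, pullback.lift_fst_assoc]
    rfl
  · intro s
    exact pullback.lift_snd _ _ _
  · intro s
    rw [exceptionalChartToBlowUp, pullback.lift_fst_assoc, pullback.lift_fst]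
  · intro s m h1 h2
    refine pullback.hom_ext ?_ ?_
    · rw [pullback.lift_fst]
      refine pullback.hom_ext ?_ ?_
      · rw [pullback.lift_fst, Category.assoc]
        exact h2
      · rw [← cancel_mono (center L hL), Category.assoc, Category.assoc, Category.assoc,
          ← pullback.condition, pullback.lift_fst_assoc, ← h2]
        simp only [exceptionalChartToBlowUp, Category.assoc]
    · rw [pullback.lift_snd]
      exact h1

variable (I : Ideal (CoordRing k V))

theorem subschemeToBlowUp_comp :
    subschemeToBlowUp L I ≫ (graph L).imageι = subschemeToProduct L I := by
  rw [subschemeToBlowUp, Category.assoc, toBlowUp, Scheme.Hom.toImage_imageι, subschemeToProduct]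

/-- The intersection `Λ` can be computed in the product of the projective completions, where the
closure of `X` is the same as in the blow-up. -/
theorem lambdaIdeal_eq_topIdeal : lambdaIdeal L hL I =
    topIdeal ((subschemeToProduct L I).ker.comap (quotientAtInfinity L hL)) := by
  have h := (IsPullback.of_hasPullback (subschemeToBlowUp L I).imageι
    (exceptionalChartToBlowUp L hL)).flip.paste_horiz (isPullback_exceptionalChart L hL)
  have h1 : ((subschemeToBlowUp L I).imageι ≫ (graph L).imageι).ker =
      (subschemeToProduct L I).ker := by
    rw [← subschemeToBlowUp_comp, Scheme.Hom.ker_comp, Scheme.Hom.ker_comp]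
    congr 1
    exact Scheme.IdealSheafData.ker_subschemeι _
  rw [lambdaIdeal, ← topIdeal_ker, ← h1,
    ← Scheme.IdealSheafData.ker_fst_of_isClosedImmersion,
    ← Scheme.Hom.ker_comp_of_isIso h.isoPullback.hom, IsPullback.isoPullback_hom_fst]

variable {L hL} {H : Submodule k V} (hLH : IsCompl L H)
  {ℓ : Module.Dual k V} (hℓ : IsLineCoord hL H ℓ)

/-- The copy of `V / L` in the exceptional divisor is the divisor `u = 0` of the chart
`V / L × A¹`. -/
theorem quotientAtInfinity_eq : quotientAtInfinity L hL =
    Spec.map (CommRingCat.ofHom (Polynomial.aevalTower (AlgHom.id k (CoordRing k (V ⧸ L)))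
      (0 : CoordRing k (V ⧸ L))).toRingHom) ≫ infinityChart hLH hℓ := by
  set g := Polynomial.aevalTower (AlgHom.id k (CoordRing k (V ⧸ L))) (0 : CoordRing k (V ⧸ L))
    with hg
  have h1 : (g.toLinearMap ∘ₗ infinityCoords hL hLH) =
      (Algebra.ofId k (CoordRing k (V ⧸ L))).toLinearMap ∘ₗ
        Module.Dual.eval k (V × k) (spanningVector L hL, 0) := by
    ext ψ
    rw [LinearMap.comp_apply, infinityCoords_apply, AlgHom.toLinearMap_apply, map_add, map_mul, hg,
      Polynomial.aevalTower_X, zero_mul, zero_add, AlgHom.commutes]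
    rfl
  refine pullback.hom_ext ?_ ?_
  · rw [quotientAtInfinity, pullback.lift_fst, Category.assoc, infinityChart, pullback.lift_fst,
      center]
    have hu := (isUnit_infinityCoords_line hLH hℓ).map g
    have hu' : IsUnit (Algebra.ofId k (CoordRing k (V ⧸ L))
        (Module.Dual.eval k (V × k) (spanningVector L hL, 0) (ℓ ∘ₗ LinearMap.fst k V k))) := by
      have := congr($h1 (ℓ ∘ₗ LinearMap.fst k V k))
      rw [LinearMap.comp_apply, LinearMap.comp_apply, AlgHom.toLinearMap_apply,
        AlgHom.toLinearMap_apply] at this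
      rwa [← this]
    rw [comp_toProjectiveSpace _ _ g _ hu]
    refine (comp_toProjectiveSpace _ _ (Algebra.ofId k (CoordRing k (V ⧸ L))) _ hu').trans ?_
    simp only [h1]
  · rw [quotientAtInfinity, pullback.lift_snd, Category.assoc, infinityChart, pullback.lift_snd,
      ← Spec.map_comp_assoc, ← CommRingCat.ofHom_comp]
    have h2 : g.toRingHom.comp Polynomial.C = RingHom.id _ := by
      exact RingHom.ext fun r => Polynomial.aevalTower_C _ _ _
    rw [h2]
    exact ((Spec.map_id _ =≫ _).trans (Category.id_comp _)).symm

include hLH hℓ in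
/-- The ideal of `Λ` consists of the values at `u = 0` of those polynomials in `u` over `k[V / L]`
that vanish on the open subscheme `ℓ ≠ 0` of `X` for `u = ℓ⁻¹`. -/
theorem lambdaIdeal_eq_map : lambdaIdeal L hL I =
    (RingHom.ker (infinityRestriction L I ℓ).toRingHom).map
      (Polynomial.aevalTower (AlgHom.id k (CoordRing k (V ⧸ L)))
        (0 : CoordRing k (V ⧸ L))).toRingHom := by
  rw [lambdaIdeal_eq_topIdeal, quotientAtInfinity_eq hLH hℓ, Scheme.IdealSheafData.comap_comp,
    ker_subschemeToProduct_comap, topIdeal_comap, topIdeal_ker, idealOfImage_specMap]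

end Infinity

/-! ### Functions on `V` as polynomials in a coordinate of the line -/

section Splitting

variable {k V : Type u} [Field k] [AddCommGroup V] [Module k V] {L : Submodule k V}
  {hL : Module.finrank k L = 1} {H : Submodule k V} (hLH : IsCompl L H)
  {ℓ : Module.Dual k V} (hℓ : IsLineCoord hL H ℓ)

/-- The isomorphism of `k[V]` with the polynomial ring over `k[V / L]` in the variable `ℓ`. -/
def splitEquiv : CoordRing k V ≃ₐ[k] Polynomial (CoordRing k (V ⧸ L)) :=
  AlgEquiv.ofAlgHom
    (SymmetricAlgebra.lift (Polynomial.CAlgHom.toLinearMap ∘ₗ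
        SymmetricAlgebra.ι k (Module.Dual k (V ⧸ L)) ∘ₗ (quotientSection hLH).dualMap +
      (Module.Dual.eval k V (spanningVector L hL)).smulRight Polynomial.X))
    (Polynomial.aevalTower (pullbackHom L.mkQ) (SymmetricAlgebra.ι k _ ℓ))
    (by
      have h1 : ℓ ∘ₗ quotientSection hLH = 0 := hℓ.comp_quotientSection hLH
      refine Polynomial.algHom_ext' ?_ ?_
      · apply SymmetricAlgebra.algHom_ext
        ext φ : 1
        have h2 : (φ ∘ₗ L.mkQ) ∘ₗ quotientSection hLH = φ := by
          rw [LinearMap.comp_assoc, mkQ_comp_quotientSection, LinearMap.comp_id]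
        have h3 : φ (L.mkQ (spanningVector L hL)) = 0 := by
          rw [Submodule.mkQ_apply, (Submodule.Quotient.mk_eq_zero L).2 (spanningVector_mem L hL),
            map_zero]
        change SymmetricAlgebra.lift _ (Polynomial.aevalTower _ _ (Polynomial.C _)) = _
        rw [Polynomial.aevalTower_C, pullbackHom_ι, SymmetricAlgebra.lift_ι_apply]
        change Polynomial.C (SymmetricAlgebra.ι k (Module.Dual k (V ⧸ L))
          ((φ ∘ₗ L.mkQ) ∘ₗ quotientSection hLH)) + φ (L.mkQ (spanningVector L hL)) • _ = _
        rw [h2, h3, zero_smul, add_zero]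
        rfl
      · rw [AlgHom.comp_apply, Polynomial.aevalTower_X, SymmetricAlgebra.lift_ι_apply]
        change Polynomial.C (SymmetricAlgebra.ι k (Module.Dual k (V ⧸ L))
          (ℓ ∘ₗ quotientSection hLH)) + ℓ (spanningVector L hL) • _ = _
        rw [h1, map_zero, map_zero, hℓ.apply_spanningVector, one_smul, zero_add]
        rfl)
    (by
      apply SymmetricAlgebra.algHom_ext
      ext φ : 1
      change Polynomial.aevalTower _ _ (SymmetricAlgebra.lift _ (SymmetricAlgebra.ι k _ φ)) = _
      rw [SymmetricAlgebra.lift_ι_apply, LinearMap.add_apply, map_add]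
      change Polynomial.aevalTower _ _ (Polynomial.C (SymmetricAlgebra.ι k (Module.Dual k (V ⧸ L))
        (φ ∘ₗ quotientSection hLH))) + Polynomial.aevalTower _ _ (φ (spanningVector L hL) • _) =
          SymmetricAlgebra.ι k (Module.Dual k V) φ
      rw [Polynomial.aevalTower_C, map_smul, Polynomial.aevalTower_X, pullbackHom_ι]
      conv_rhs => rw [hℓ.dual_decomposition hLH φ, map_add, map_smul])

theorem splitEquiv_symm_C (r : CoordRing k (V ⧸ L)) :
    (splitEquiv hLH hℓ).symm (Polynomial.C r) = pullbackHom L.mkQ r :=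
  Polynomial.aevalTower_C _ _ _

theorem splitEquiv_symm_X : (splitEquiv hLH hℓ).symm Polynomial.X = SymmetricAlgebra.ι k _ ℓ :=
  Polynomial.aevalTower_X _ _

theorem splitEquiv_symm_monomial (n : ℕ) (r : CoordRing k (V ⧸ L)) :
    (splitEquiv hLH hℓ).symm (Polynomial.monomial n r) =
      pullbackHom L.mkQ r * SymmetricAlgebra.ι k _ ℓ ^ n := by
  rw [← Polynomial.C_mul_X_pow_eq_monomial, map_mul, map_pow, splitEquiv_symm_C, splitEquiv_symm_X]

theorem splitEquiv_pullbackHom (r : CoordRing k (V ⧸ L)) :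
    splitEquiv hLH hℓ (pullbackHom L.mkQ r) = Polynomial.C r := by
  rw [← splitEquiv_symm_C hLH hℓ, AlgEquiv.apply_symm_apply]

theorem splitEquiv_line :
    splitEquiv hLH hℓ (SymmetricAlgebra.ι k _ ℓ) = Polynomial.X := by
  rw [← splitEquiv_symm_X hLH hℓ, AlgEquiv.apply_symm_apply]

theorem splitEquiv_ι (φ : Module.Dual k V) : splitEquiv hLH hℓ (SymmetricAlgebra.ι k _ φ) =
    Polynomial.C (SymmetricAlgebra.ι k (Module.Dual k (V ⧸ L)) (φ ∘ₗ quotientSection hLH)) +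
      φ (spanningVector L hL) • Polynomial.X :=
  SymmetricAlgebra.lift_ι_apply _ _

include hLH hℓ in
/-- Two homomorphisms on `k[V]` are equal if they agree on `k[V / L]` and on `ℓ`. -/
theorem ringHom_ext_of_split {S : Type*} [CommRing S] {f g : CoordRing k V →+* S}
    (h1 : ∀ r, f (pullbackHom L.mkQ r) = g (pullbackHom L.mkQ r))
    (h2 : f (SymmetricAlgebra.ι k _ ℓ) = g (SymmetricAlgebra.ι k _ ℓ)) : f = g := by
  have : f.comp ((splitEquiv hLH hℓ).symm : Polynomial (CoordRing k (V ⧸ L)) →+* CoordRing k V) =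
      g.comp ((splitEquiv hLH hℓ).symm : Polynomial (CoordRing k (V ⧸ L)) →+* CoordRing k V) := by
    refine Polynomial.ringHom_ext (fun r => ?_) ?_
    · simpa [splitEquiv_symm_C] using h1 r
    · simpa [splitEquiv_symm_X] using h2
  refine RingHom.ext fun a => ?_
  have h := congr($this (splitEquiv hLH hℓ a))
  simpa using h

/-- The ideal `I` of `X`, transported to the polynomial ring in `ℓ` over `k[V / L]`. -/
def polyIdeal (I : Ideal (CoordRing k V)) : Ideal (Polynomial (CoordRing k (V ⧸ L))) :=
  I.comap (splitEquiv hLH hℓ).symm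

theorem mem_polyIdeal {I : Ideal (CoordRing k V)} {p : Polynomial (CoordRing k (V ⧸ L))} :
    p ∈ polyIdeal hLH hℓ I ↔ (splitEquiv hLH hℓ).symm p ∈ I :=
  Iff.rfl

theorem mem_leadingCoeffNth_iff {R : Type*} [CommRing R] (J : Ideal (Polynomial R)) (n : ℕ)
    (x : R) : x ∈ J.leadingCoeffNth n ↔ ∃ p ∈ J, p.natDegree ≤ n ∧ p.coeff n = x := by
  constructor
  · rintro ⟨p, hp, rfl⟩
    rw [SetLike.mem_coe, Ideal.degreeLE, Submodule.mem_inf, Polynomial.mem_degreeLE] at hp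
    exact ⟨p, hp.2, Polynomial.natDegree_le_iff_degree_le.2 hp.1, rfl⟩
  · rintro ⟨p, hp, hn, rfl⟩
    exact ⟨p, Submodule.mem_inf.2 ⟨Polynomial.mem_degreeLE.2
      (Polynomial.natDegree_le_iff_degree_le.1 hn), hp⟩, rfl⟩

theorem mem_leadingCoeff_iff_exists {R : Type*} [CommRing R] (J : Ideal (Polynomial R)) (x : R) :
    x ∈ J.leadingCoeff ↔ ∃ n, x ∈ J.leadingCoeffNth n := by
  constructor
  · rw [Ideal.mem_leadingCoeff]
    rintro ⟨p, hp, rfl⟩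
    exact ⟨p.natDegree, (mem_leadingCoeffNth_iff _ _ _).2 ⟨p, hp, le_rfl, rfl⟩⟩
  · rintro ⟨n, hn⟩
    exact Ideal.mem_iSup_of_mem n hn

/-- The ideal of `Π` consists of the elements of `I` of degree zero in `ℓ`. -/
theorem mem_projectionIdeal_iff (I : Ideal (CoordRing k V)) (r : CoordRing k (V ⧸ L)) :
    r ∈ projectionIdeal L I ↔ r ∈ (polyIdeal hLH hℓ I).leadingCoeffNth 0 := by
  rw [Ideal.mem_leadingCoeffNth_zero, mem_polyIdeal, splitEquiv_symm_C]
  rfl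

theorem mem_cylinderIdeal_iff (J : Ideal (CoordRing k (V ⧸ L))) (f : CoordRing k V) :
    f ∈ cylinderIdeal L J ↔ ∀ n, (splitEquiv hLH hℓ f).coeff n ∈ J := by
  rw [← Ideal.mem_map_C_iff]
  have h : cylinderIdeal L J = (J.map Polynomial.C).map (splitEquiv hLH hℓ).symm := by
    have : (((splitEquiv hLH hℓ).symm : Polynomial (CoordRing k (V ⧸ L)) →+* CoordRing k V)).comp
        Polynomial.C = (pullbackHom L.mkQ : CoordRing k (V ⧸ L) →+* CoordRing k V) :=
      RingHom.ext fun r => splitEquiv_symm_C hLH hℓ r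
    refine Eq.trans ?_ (Ideal.map_map Polynomial.C
      ((splitEquiv hLH hℓ).symm : Polynomial (CoordRing k (V ⧸ L)) →+* CoordRing k V)).symm
    rw [this]
    rfl
  rw [h, Ideal.mem_map_of_equiv]
  constructor
  · rintro ⟨p, hp, rfl⟩
    rwa [AlgEquiv.apply_symm_apply]
  · intro hf
    exact ⟨_, hf, AlgEquiv.symm_apply_apply _ _⟩

/-- Restriction of functions to `H ≅ V / L` is evaluation at `ℓ = 0`. -/
theorem pullbackHom_quotientSection (f : CoordRing k V) :
    pullbackHom (quotientSection hLH) f = (splitEquiv hLH hℓ f).coeff 0 := by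
  have : (pullbackHom (quotientSection hLH) : CoordRing k V →+* CoordRing k (V ⧸ L)) =
      Polynomial.constantCoeff.comp
        (splitEquiv hLH hℓ : CoordRing k V →+* Polynomial (CoordRing k (V ⧸ L))) := by
    refine ringHom_ext_of_split hLH hℓ (fun r => ?_) ?_
    · have h : (pullbackHom (quotientSection hLH)).comp (pullbackHom L.mkQ) =
          AlgHom.id k (CoordRing k (V ⧸ L)) := by
        apply SymmetricAlgebra.algHom_ext
        ext φ : 1
        change pullbackHom _ (pullbackHom _ (SymmetricAlgebra.ι k _ φ)) =
          SymmetricAlgebra.ι k (Module.Dual k (V ⧸ L)) φ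
        rw [pullbackHom_ι, pullbackHom_ι, LinearMap.comp_assoc, mkQ_comp_quotientSection,
          LinearMap.comp_id]
      refine (congr($h r)).trans ?_
      simp [splitEquiv_pullbackHom]
    · simp only [RingHom.coe_coe, RingHom.comp_apply, splitEquiv_line]
      rw [pullbackHom_ι, hℓ.comp_quotientSection]
      simp
  exact congr($this f)

theorem mem_horizontalIdeal_iff (J : Ideal (CoordRing k (V ⧸ L))) (f : CoordRing k V) :
    f ∈ horizontalIdeal hLH J ↔ (splitEquiv hLH hℓ f).coeff 0 ∈ J := by
  rw [← pullbackHom_quotientSection]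
  rfl

/-- The ideal of `Λ` is the ideal of leading coefficients of the elements of `I` as polynomials
in `ℓ`: a polynomial in `u = ℓ⁻¹` that vanishes on the part of `X` where `ℓ` is invertible, times a
large power of `ℓ`, is an element of `I`, and its leading coefficient is the value at `u = 0`. -/
theorem mem_lambdaIdeal_iff (I : Ideal (CoordRing k V)) (r : CoordRing k (V ⧸ L)) :
    r ∈ lambdaIdeal L hL I ↔ r ∈ (polyIdeal hLH hℓ I).leadingCoeff := by
  set x := Ideal.Quotient.mk I (SymmetricAlgebra.ι k _ ℓ)
  -- restriction of functions on `V` to the open subscheme of `X` where `ℓ` is invertible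
  set q := toAwayQuotient I ℓ
  have hinv := toAwayQuotient_mul_lineInv (ℓ := ℓ) I
  let : Invertible (q (SymmetricAlgebra.ι k _ ℓ)) :=
    ⟨lineInv I ℓ, by rw [mul_comm]; exact hinv, hinv⟩
  -- a polynomial in `u = ℓ⁻¹` times `ℓ ^ N` is the reflected polynomial in `ℓ`
  have key (g : Polynomial (CoordRing k (V ⧸ L))) (N : ℕ) (hg : g.natDegree ≤ N) :
      infinityRestriction L I ℓ (Polynomial.reflect N g) * q (SymmetricAlgebra.ι k _ ℓ) ^ N =
        q ((splitEquiv hLH hℓ).symm g) := by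
    have h1 := Polynomial.eval₂_reflect_mul_pow
      (q.comp (pullbackHom L.mkQ) : CoordRing k (V ⧸ L) →+* AwayQuotient I ℓ)
      (q (SymmetricAlgebra.ι k _ ℓ)) N g hg
    refine Eq.trans h1 ?_
    have h2 : (q : CoordRing k V →+* AwayQuotient I ℓ).comp
        ((splitEquiv hLH hℓ).symm : Polynomial (CoordRing k (V ⧸ L)) →+* CoordRing k V) =
        Polynomial.eval₂RingHom (q.comp (pullbackHom L.mkQ) :
          CoordRing k (V ⧸ L) →+* AwayQuotient I ℓ) (q (SymmetricAlgebra.ι k _ ℓ)) := by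
      refine Polynomial.ringHom_ext (fun r => ?_) ?_
      · simp [splitEquiv_symm_C]
      · simp [splitEquiv_symm_X]
    exact congr($h2 g).symm
  have hq0 (a : CoordRing k V) (ha : q a = 0) :
      ∃ m : ℕ, SymmetricAlgebra.ι k _ ℓ ^ m * a ∈ I := by
    have h1 : algebraMap (CoordRing k V ⧸ I) (AwayQuotient I ℓ) (Ideal.Quotient.mk I a) = 0 := ha
    obtain ⟨⟨_, m, rfl⟩, hm⟩ := (IsLocalization.map_eq_zero_iff (Submonoid.powers x) _ _).1 h1
    refine ⟨m, ?_⟩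
    rw [← Ideal.Quotient.eq_zero_iff_mem, map_mul, map_pow]
    exact hm
  rw [lambdaIdeal_eq_map I hLH hℓ, Ideal.mem_map_iff_of_surjective _ (fun r =>
    ⟨Polynomial.C r, Polynomial.aevalTower_C _ _ _⟩), mem_leadingCoeff_iff_exists]
  have hev (g : Polynomial (CoordRing k (V ⧸ L))) :
      (Polynomial.aevalTower (AlgHom.id k (CoordRing k (V ⧸ L)))
        (0 : CoordRing k (V ⧸ L))).toRingHom g = g.coeff 0 := by
    have h2 : (Polynomial.aevalTower (AlgHom.id k (CoordRing k (V ⧸ L)))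
        (0 : CoordRing k (V ⧸ L))).toRingHom = Polynomial.constantCoeff := by
      refine Polynomial.ringHom_ext (fun r => ?_) ?_
      · simp [Polynomial.aevalTower_C]
      · simp [Polynomial.aevalTower_X]
    exact congr($h2 g)
  constructor
  · rintro ⟨g, hg, rfl⟩
    rw [hev]
    obtain ⟨m, hm⟩ := hq0 ((splitEquiv hLH hℓ).symm (Polynomial.reflect g.natDegree g)) (by
      rw [← key _ g.natDegree (Polynomial.natDegree_reflect_le.trans (by simp)),
        Polynomial.reflect_reflect]
      have : infinityRestriction L I ℓ g = 0 := hg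
      rw [this, zero_mul])
    refine ⟨m + g.natDegree, (mem_leadingCoeffNth_iff _ _ _).2
      ⟨Polynomial.X ^ m * Polynomial.reflect g.natDegree g, ?_, ?_, ?_⟩⟩
    · rw [mem_polyIdeal, map_mul, map_pow, splitEquiv_symm_X]
      exact hm
    · refine Polynomial.natDegree_mul_le.trans (add_le_add (Polynomial.natDegree_X_pow_le m)
        (Polynomial.natDegree_reflect_le.trans (by simp)))
    · rw [add_comm, Polynomial.coeff_X_pow_mul, Polynomial.coeff_reflect,
        Polynomial.revAt_le le_rfl, Nat.sub_self]
  · rintro ⟨n, hn⟩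
    obtain ⟨p, hp, hd, rfl⟩ := (mem_leadingCoeffNth_iff _ _ _).1 hn
    refine ⟨Polynomial.reflect n p, ?_, ?_⟩
    · have h1 := key p n hd
      have h2 : q ((splitEquiv hLH hℓ).symm p) = 0 := by
        have : Ideal.Quotient.mk I ((splitEquiv hLH hℓ).symm p) = 0 :=
          Ideal.Quotient.eq_zero_iff_mem.2 hp
        exact (congrArg (algebraMap (CoordRing k V ⧸ I) (AwayQuotient I ℓ)) this).trans (map_zero _)
      rw [h2] at h1
      have h3 : IsUnit (q (SymmetricAlgebra.ι k _ ℓ) ^ n) := (isUnit_of_invertible _).pow n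
      exact (h3.mul_left_eq_zero).1 h1
    · rw [hev, Polynomial.coeff_reflect, Polynomial.revAt_le (Nat.zero_le _), Nat.sub_zero]

end Splitting

/-! ### The flat limit -/

section FlatLimit

open LaurentPolynomial

variable {k V : Type u} [Field k] [AddCommGroup V] [Module k V] {L : Submodule k V}
  {hL : Module.finrank k L = 1} {H : Submodule k V} (hLH : IsCompl L H)
  {ℓ : Module.Dual k V} (hℓ : IsLineCoord hL H ℓ)

theorem inverseScaling_ι (φ : Module.Dual k V) :
    inverseScaling hLH (SymmetricAlgebra.ι k _ φ) =
      C (SymmetricAlgebra.ι k (Module.Dual k V) (φ ∘ₗ H.projection L hLH.symm)) +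
        C (SymmetricAlgebra.ι k (Module.Dual k V) (φ ∘ₗ L.projection H hLH)) * T (-1) :=
  SymmetricAlgebra.lift_ι_apply _ _

theorem inverseScaling_pullbackHom (r : CoordRing k (V ⧸ L)) :
    inverseScaling hLH (pullbackHom L.mkQ r) = C (pullbackHom L.mkQ r) := by
  have h : (inverseScaling hLH).comp (pullbackHom L.mkQ) =
      (IsScalarTower.toAlgHom k (CoordRing k V) (CoordRing k V)[T;T⁻¹]).comp
        (pullbackHom L.mkQ) := by
    apply SymmetricAlgebra.algHom_ext
    ext φ : 1
    have h1 : (φ ∘ₗ L.mkQ) ∘ₗ L.projection H hLH = 0 := by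
      ext v
      have : L.mkQ (L.projection H hLH v) = 0 :=
        (Submodule.Quotient.mk_eq_zero L).2 (Submodule.projection_apply_mem hLH v)
      simp [this]
    have h2 : (φ ∘ₗ L.mkQ) ∘ₗ H.projection L hLH.symm = φ ∘ₗ L.mkQ := by
      ext v
      have h3 := Submodule.projection_add_projection_eq_self hLH v
      have h4 : (φ ∘ₗ L.mkQ) (L.projection H hLH v) = 0 := congr($h1 v)
      conv_rhs => rw [← h3, map_add, h4, zero_add]
      rfl
    change inverseScaling hLH (pullbackHom _ (SymmetricAlgebra.ι k _ φ)) =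
      C (pullbackHom _ (SymmetricAlgebra.ι k _ φ))
    rw [pullbackHom_ι, inverseScaling_ι, h1, h2, map_zero, map_zero, zero_mul, add_zero]
  exact congr($h r)

include hℓ in
theorem inverseScaling_line :
    inverseScaling hLH (SymmetricAlgebra.ι k _ ℓ) = C (SymmetricAlgebra.ι k _ ℓ) * T (-1) := by
  have h1 : ℓ ∘ₗ H.projection L hLH.symm = 0 := by
    ext v
    exact hℓ.apply_of_mem _ (Submodule.projection_apply_mem hLH.symm v)
  have h2 : ℓ ∘ₗ L.projection H hLH = ℓ := by
    ext v
    have h3 := Submodule.projection_add_projection_eq_self hLH v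
    have h4 := congr($h1 v)
    simp only [LinearMap.comp_apply, LinearMap.zero_apply] at h4
    conv_rhs => rw [← h3]
    simp [h4]
  rw [inverseScaling_ι, h1, h2, map_zero, map_zero, zero_add]

theorem inverseScaling_monomial (n : ℕ) (r : CoordRing k (V ⧸ L)) :
    inverseScaling hLH ((splitEquiv hLH hℓ).symm (Polynomial.monomial n r)) =
      C ((splitEquiv hLH hℓ).symm (Polynomial.monomial n r)) * T (-n) := by
  rw [splitEquiv_symm_monomial, map_mul, map_pow, inverseScaling_pullbackHom,
    inverseScaling_line hLH hℓ, mul_pow, T_pow, map_mul, map_pow, mul_assoc]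
  congr 3
  ring

/-- The endomorphism of the functions on the product of `V` and the punctured line that multiplies
`ℓ` by the coordinate of the line; it is inverse to the scaling. -/
def directScaling : (CoordRing k V)[T;T⁻¹] →+* (CoordRing k V)[T;T⁻¹] :=
  LaurentPolynomial.eval₂
    (((Polynomial.eval₂RingHom (C.comp (pullbackHom L.mkQ : CoordRing k (V ⧸ L) →+* CoordRing k V))
      (C (SymmetricAlgebra.ι k _ ℓ) * T 1))).comp
        (splitEquiv hLH hℓ : CoordRing k V →+* Polynomial (CoordRing k (V ⧸ L))))
    ⟨T 1, T (-1), by rw [← T_add]; exact T_zero, by rw [← T_add]; exact T_zero⟩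

theorem directScaling_T (n : ℕ) : directScaling hLH hℓ (T n) = T n := by
  rw [directScaling, eval₂_T_n, T_pow, mul_one]

theorem directScaling_C_monomial (n : ℕ) (r : CoordRing k (V ⧸ L)) :
    directScaling hLH hℓ (C ((splitEquiv hLH hℓ).symm (Polynomial.monomial n r))) =
      C ((splitEquiv hLH hℓ).symm (Polynomial.monomial n r)) * T n := by
  rw [directScaling, eval₂_C, splitEquiv_symm_monomial, RingHom.comp_apply]
  simp only [RingHom.coe_coe, map_mul, map_pow, splitEquiv_pullbackHom, splitEquiv_line,
    Polynomial.coe_eval₂RingHom, Polynomial.eval₂_C, Polynomial.eval₂_X, mul_assoc]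
  rw [mul_pow, T_pow, mul_one]
  rfl

theorem directScaling_inverseScaling (a : CoordRing k V) :
    directScaling hLH hℓ (inverseScaling hLH a) = C a := by
  have h : (directScaling hLH hℓ).comp
      (inverseScaling hLH : CoordRing k V →+* (CoordRing k V)[T;T⁻¹]) = C := by
    have hT : directScaling hLH hℓ (T (-1)) = T (-1) := by
      simp [directScaling]
    refine ringHom_ext_of_split hLH hℓ (fun r => ?_) ?_
    · have := directScaling_C_monomial hLH hℓ 0 r
      rw [Polynomial.monomial_zero_left, splitEquiv_symm_C] at this
      simpa [inverseScaling_pullbackHom] using this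
    · have := directScaling_C_monomial hLH hℓ 1 1
      rw [Polynomial.monomial_one_one_eq_X, splitEquiv_symm_X] at this
      rw [RingHom.comp_apply, RingHom.coe_coe, inverseScaling_line hLH hℓ, map_mul, this, hT,
        mul_assoc, ← T_add]
      simp
  exact congr($h a)

theorem coeff_mem_of_mem_map_C {A : Type*} [CommRing A] {J : Ideal A} {g : A[T;T⁻¹]}
    (hg : g ∈ J.map (C : A →+* A[T;T⁻¹])) (n : ℤ) : g.coeff n ∈ J := by
  have h : J.map (C : A →+* A[T;T⁻¹]) ≤
      RingHom.ker (AddMonoidAlgebra.mapRingHom ℤ (Ideal.Quotient.mk J)) := by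
    rw [Ideal.map_le_iff_le_comap]
    intro a ha
    rw [Ideal.mem_comap, RingHom.mem_ker, ← single_eq_C, AddMonoidAlgebra.mapRingHom_single,
      Ideal.Quotient.eq_zero_iff_mem.2 ha, AddMonoidAlgebra.single_zero]
  have h1 : (AddMonoidAlgebra.mapRingHom ℤ (Ideal.Quotient.mk J) g).coeff n = 0 := by
    rw [RingHom.mem_ker.1 (h hg)]
    rfl
  rwa [← Ideal.Quotient.eq_zero_iff_mem]

/-- The flat limit is defined by the initial forms with respect to the degree in `ℓ`. -/
theorem mem_flatLimitIdeal_iff (I : Ideal (CoordRing k V)) (f : CoordRing k V) :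
    f ∈ flatLimitIdeal hLH I ↔
      ∀ n, (splitEquiv hLH hℓ f).coeff n ∈ (polyIdeal hLH hℓ I).leadingCoeffNth n := by
  set e := splitEquiv hLH hℓ with he
  rw [flatLimitIdeal, Ideal.mem_map_iff_of_surjective _
    (fun r => ⟨Polynomial.C r, by simp⟩)]
  constructor
  · rintro ⟨p, hp, rfl⟩ n
    have h1 : directScaling hLH hℓ (Polynomial.toLaurent p) ∈ I.map C := by
      have h2 := Ideal.mem_map_of_mem (directScaling hLH hℓ) (Ideal.mem_comap.1 hp)
      rw [scaledFamilyIdeal] at h2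
      have h3 : (I.map (inverseScaling hLH)).map (directScaling hLH hℓ) ≤ I.map C := by
        rw [Ideal.map_le_iff_le_comap, Ideal.map_le_iff_le_comap]
        intro a ha
        rw [Ideal.mem_comap, Ideal.mem_comap, directScaling_inverseScaling]
        exact Ideal.mem_map_of_mem _ ha
      exact h3 h2
    have h4 := coeff_mem_of_mem_map_C h1 n
    -- the coefficient of `T ^ n` is a polynomial in `ℓ` of degree at most `n`, and its top
    -- coefficient comes from `T ^ 0` alone
    have key : ∀ p : Polynomial (CoordRing k V),
        (e ((directScaling hLH hℓ (Polynomial.toLaurent p)).coeff n)).natDegree ≤ n ∧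
        (e ((directScaling hLH hℓ (Polynomial.toLaurent p)).coeff n)).coeff n =
          (e (p.eval 0)).coeff n := by
      intro p
      induction p using Polynomial.induction_on' with
      | add p q hp hq =>
        simp only [map_add, AddMonoidAlgebra.coeff_add, Finsupp.add_apply, Polynomial.eval_add,
          Polynomial.coeff_add, hp.2, hq.2, and_true]
        exact Polynomial.natDegree_add_le_of_degree_le hp.1 hq.1
      | monomial j a =>
        obtain ⟨a, rfl⟩ := e.symm.surjective a
        induction a using Polynomial.induction_on' with
        | add a b ha hb =>
          simp only [map_add, AddMonoidAlgebra.coeff_add, Finsupp.add_apply, Polynomial.eval_add,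
            Polynomial.coeff_add, ha.2, hb.2, and_true]
          exact Polynomial.natDegree_add_le_of_degree_le ha.1 hb.1
        | monomial i r =>
          rw [← Polynomial.C_mul_X_pow_eq_monomial, Polynomial.toLaurent_C_mul_X_pow, map_mul,
            directScaling_T, directScaling_C_monomial, mul_assoc, ← T_add, ← single_eq_C_mul_T]
          simp only [AddMonoidAlgebra.coeff_single, Finsupp.single_apply]
          rw [Polynomial.eval_mul, Polynomial.eval_C, Polynomial.eval_pow, Polynomial.eval_X]
          split_ifs with hij
          · have hij' : i + j = n := by exact_mod_cast hij
            rw [AlgEquiv.apply_symm_apply]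
            refine ⟨(Polynomial.natDegree_monomial_le _).trans (by omega), ?_⟩
            rcases Nat.eq_zero_or_pos j with rfl | hj
            · rw [pow_zero, mul_one, AlgEquiv.apply_symm_apply]
            · rw [zero_pow hj.ne', mul_zero, map_zero, Polynomial.coeff_zero,
                Polynomial.coeff_monomial, if_neg (by omega)]
          · rw [map_zero]
            refine ⟨by simp, ?_⟩
            rcases Nat.eq_zero_or_pos j with rfl | hj
            · rw [pow_zero, mul_one, AlgEquiv.apply_symm_apply, Polynomial.coeff_zero,
                Polynomial.coeff_monomial, if_neg (by rintro rfl; simp at hij)]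
            · rw [zero_pow hj.ne', mul_zero, map_zero]
    refine (mem_leadingCoeffNth_iff _ _ _).2 ⟨_, ?_, (key p).1, (key p).2⟩
    rw [mem_polyIdeal, ← he, AlgEquiv.symm_apply_apply]
    exact h4
  · intro h
    rw [← Ideal.mem_map_iff_of_surjective _ (fun r => ⟨Polynomial.C r, by simp⟩)]
    have h0 : f = ∑ n ∈ Finset.range ((e f).natDegree + 1),
        e.symm (Polynomial.monomial n ((e f).coeff n)) := by
      rw [← map_sum, ← Polynomial.as_sum_range, AlgEquiv.symm_apply_apply]
    rw [h0]
    refine sum_mem fun n _ => ?_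
    obtain ⟨q, hq, hd, hc⟩ := (mem_leadingCoeffNth_iff _ _ _).1 (h n)
    rw [← hc, Ideal.mem_map_iff_of_surjective _ (fun r => ⟨Polynomial.C r, by simp⟩)]
    -- the polynomial `t ^ n q(ℓ / t)` in `t`
    refine ⟨∑ i ∈ Finset.range (n + 1),
      Polynomial.monomial (n - i) (e.symm (Polynomial.monomial i (q.coeff i))), ?_, ?_⟩
    · have h5 : Polynomial.toLaurent (∑ i ∈ Finset.range (n + 1),
          Polynomial.monomial (n - i) (e.symm (Polynomial.monomial i (q.coeff i)))) =
          T n * inverseScaling hLH (e.symm q) := by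
        conv_rhs => rw [Polynomial.as_sum_range' q (n + 1) (by omega)]
        rw [map_sum, map_sum, map_sum, Finset.mul_sum]
        refine Finset.sum_congr rfl fun i hi => ?_
        have hi' : i ≤ n := by simpa [Nat.lt_succ_iff] using hi
        rw [inverseScaling_monomial, mul_left_comm, ← T_add, ← Polynomial.C_mul_X_pow_eq_monomial,
          Polynomial.toLaurent_C_mul_X_pow]
        push_cast [hi']
        rfl
      rw [familyClosureIdeal, Ideal.mem_comap, h5]
      exact Ideal.mul_mem_left _ _ (Ideal.mem_map_of_mem _ hq)
    · rw [map_sum, Finset.sum_range_succ, Nat.sub_self, Finset.sum_eq_zero, zero_add]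
      · simp
      · intro i hi
        have hi' : n - i ≠ 0 := by have := Finset.mem_range.1 hi; omega
        simp [Polynomial.eval_monomial, hi']

end FlatLimit

section Union

variable {k V : Type u} [Field k] [AddCommGroup V] [Module k V] {L : Submodule k V}
  (hL : Module.finrank k L = 1) {H : Submodule k V} (hLH : IsCompl L H)
  (I : Ideal (CoordRing k V))

include hLH in
theorem projectionIdeal_le_lambdaIdeal : projectionIdeal L I ≤ lambdaIdeal L hL I := by
  obtain ⟨ℓ, hℓ⟩ := exists_isLineCoord hL hLH
  intro r hr
  rw [mem_projectionIdeal_iff hLH hℓ] at hr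
  rw [mem_lambdaIdeal_iff hLH hℓ]
  exact (mem_leadingCoeff_iff_exists _ _).2 ⟨0, hr⟩

include hL in
theorem horizontal_sup_cylinder {J₀ J : Ideal (CoordRing k (V ⧸ L))} (hJ : J₀ ≤ J) :
    horizontalIdeal hLH J₀ ⊔ cylinderIdeal L J = horizontalIdeal hLH J := by
  obtain ⟨ℓ, hℓ⟩ := exists_isLineCoord hL hLH
  refine le_antisymm (sup_le (Ideal.comap_mono hJ) fun f hf => ?_) fun f hf => ?_
  · rw [mem_horizontalIdeal_iff hLH hℓ]
    exact (mem_cylinderIdeal_iff hLH hℓ _ _).1 hf 0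
  · rw [mem_horizontalIdeal_iff hLH hℓ] at hf
    set e := splitEquiv hLH hℓ
    have h1 : f = (f - e.symm (Polynomial.C ((e f).coeff 0))) +
        e.symm (Polynomial.C ((e f).coeff 0)) := by ring
    rw [h1]
    refine Submodule.add_mem_sup ?_ ?_
    · rw [mem_horizontalIdeal_iff hLH hℓ, map_sub, AlgEquiv.apply_symm_apply]
      simp [e]
    · rw [mem_cylinderIdeal_iff hLH hℓ]
      intro n
      rw [AlgEquiv.apply_symm_apply, Polynomial.coeff_C]
      split_ifs
      exacts [hf, J.zero_mem]

theorem flatLimitIdeal_le : flatLimitIdeal hLH I ≤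
    horizontalIdeal hLH (projectionIdeal L I) ⊓ cylinderIdeal L (lambdaIdeal L hL I) := by
  obtain ⟨ℓ, hℓ⟩ := exists_isLineCoord hL hLH
  intro f hf
  rw [mem_flatLimitIdeal_iff hLH hℓ] at hf
  refine ⟨?_, ?_⟩
  · rw [SetLike.mem_coe, mem_horizontalIdeal_iff hLH hℓ, mem_projectionIdeal_iff hLH hℓ]
    exact hf 0
  · rw [SetLike.mem_coe, mem_cylinderIdeal_iff hLH hℓ]
    intro n
    rw [mem_lambdaIdeal_iff hLH hℓ]
    exact (mem_leadingCoeff_iff_exists _ _).2 ⟨n, hf n⟩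

/-- If `r` is a leading coefficient of degree `d`, then the power `d + 1` of `r ℓ ^ n` is an initial
form for all `n > 0`, as `n (d + 1) ≥ d`. -/
theorem le_radical_flatLimitIdeal :
    horizontalIdeal hLH (projectionIdeal L I) ⊓ cylinderIdeal L (lambdaIdeal L hL I) ≤
      (flatLimitIdeal hLH I).radical := by
  obtain ⟨ℓ, hℓ⟩ := exists_isLineCoord hL hLH
  rintro f ⟨hf1, hf2⟩
  rw [SetLike.mem_coe, mem_horizontalIdeal_iff hLH hℓ, mem_projectionIdeal_iff hLH hℓ] at hf1
  rw [SetLike.mem_coe, mem_cylinderIdeal_iff hLH hℓ] at hf2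
  set e := splitEquiv hLH hℓ with he
  have h0 : f = ∑ n ∈ Finset.range ((e f).natDegree + 1),
      e.symm (Polynomial.monomial n ((e f).coeff n)) := by
    rw [← map_sum, ← Polynomial.as_sum_range, AlgEquiv.symm_apply_apply]
  have hmon (n : ℕ) (r) (hr : r ∈ (polyIdeal hLH hℓ I).leadingCoeffNth n) :
      e.symm (Polynomial.monomial n r) ∈ flatLimitIdeal hLH I := by
    rw [mem_flatLimitIdeal_iff hLH hℓ]
    intro m
    rw [← he, AlgEquiv.apply_symm_apply, Polynomial.coeff_monomial]
    split_ifs with h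
    exacts [h ▸ hr, Ideal.zero_mem _]
  rw [h0]
  refine sum_mem fun n _ => ?_
  rcases Nat.eq_zero_or_pos n with rfl | hn
  · exact Ideal.le_radical (hmon 0 _ hf1)
  · obtain ⟨d, hd⟩ := (mem_leadingCoeff_iff_exists _ _).1
      ((mem_lambdaIdeal_iff hLH hℓ _ _).1 (hf2 n))
    refine ⟨d + 1, ?_⟩
    rw [← map_pow, Polynomial.monomial_pow]
    refine hmon _ _ (Ideal.leadingCoeffNth_mono _ ?_ (Ideal.pow_mem_of_mem _ hd _ d.succ_pos))
    nlinarith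

theorem zeroLocus_flatLimitIdeal :
    PrimeSpectrum.zeroLocus (flatLimitIdeal hLH I : Set (CoordRing k V)) =
      PrimeSpectrum.zeroLocus
          (horizontalIdeal hLH (projectionIdeal L I) : Set (CoordRing k V)) ∪
        PrimeSpectrum.zeroLocus
          (cylinderIdeal L (lambdaIdeal L hL I) : Set (CoordRing k V)) := by
  rw [← PrimeSpectrum.zeroLocus_inf]
  refine subset_antisymm ?_ (PrimeSpectrum.zeroLocus_anti_mono_ideal (flatLimitIdeal_le hL hLH I))
  rw [PrimeSpectrum.zeroLocus_subset_zeroLocus_iff]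
  exact le_radical_flatLimitIdeal hL hLH I

theorem flatLimitIdeal_eq_of_isReduced
    (h : IsReduced (CoordRing k V ⧸ flatLimitIdeal hLH I)) : flatLimitIdeal hLH I =
      horizontalIdeal hLH (projectionIdeal L I) ⊓ cylinderIdeal L (lambdaIdeal L hL I) := by
  have hr := (Ideal.isRadical_iff_quotient_reduced _).2 h
  exact le_antisymm (flatLimitIdeal_le hL hLH I)
    ((le_radical_flatLimitIdeal hL hLH I).trans hr)

end Union

/-! ### Gradings and Hilbert functions -/

section Grading

variable {k V : Type u} [Field k] [AddCommGroup V] [Module k V]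

theorem pullbackHom_mem_homogeneousPart {W : Type u} [AddCommGroup W] [Module k W] (f : V →ₗ[k] W)
    {n : ℕ} {a : CoordRing k W} (ha : a ∈ homogeneousPart k W n) :
    pullbackHom f a ∈ homogeneousPart k V n := by
  induction ha using Submodule.pow_induction_on_left' with
  | algebraMap r =>
    rw [AlgHom.commutes]
    exact SetLike.algebraMap_mem_graded _ r
  | add x y i hx hy ihx ihy => rw [map_add]; exact add_mem ihx ihy
  | mem_mul m hm i x hx ih =>
    obtain ⟨φ, rfl⟩ := hm
    rw [map_mul, pullbackHom_ι, Nat.succ_eq_one_add]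
    exact SetLike.mul_mem_graded (ι_mem_homogeneousPart_one _) ih

variable {L : Submodule k V}
  {hL : Module.finrank k L = 1} {H : Submodule k V} (hLH : IsCompl L H)
  {ℓ : Module.Dual k V} (hℓ : IsLineCoord hL H ℓ)

/-- In a homogeneous function of degree `n`, the coefficient of `ℓ ^ d` is homogeneous of degree
`n - d`. -/
theorem splitEquiv_coeff_mem {n : ℕ} {f : CoordRing k V} (hf : f ∈ homogeneousPart k V n) :
    (∀ i d, i + d = n → (splitEquiv hLH hℓ f).coeff d ∈ homogeneousPart k (V ⧸ L) i) ∧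
      (splitEquiv hLH hℓ f).natDegree ≤ n := by
  induction hf using Submodule.pow_induction_on_left' with
  | algebraMap r =>
    rw [AlgEquiv.commutes, Polynomial.algebraMap_apply]
    refine ⟨fun i d h => ?_, by simp⟩
    obtain ⟨rfl, rfl⟩ : i = 0 ∧ d = 0 := by omega
    rw [Polynomial.coeff_C_zero]
    exact SetLike.algebraMap_mem_graded _ r
  | add x y i hx hy ihx ihy =>
    rw [map_add]
    refine ⟨fun i d h => ?_, Polynomial.natDegree_add_le_of_degree_le ihx.2 ihy.2⟩
    rw [Polynomial.coeff_add]
    exact add_mem (ihx.1 i d h) (ihy.1 i d h)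
  | mem_mul m hm n x hx ih =>
    obtain ⟨φ, rfl⟩ := hm
    rw [map_mul, splitEquiv_ι]
    set a := φ ∘ₗ quotientSection hLH
    set c := φ (spanningVector L hL)
    set p := splitEquiv hLH hℓ x
    refine ⟨fun i d h => ?_, ?_⟩
    · rw [add_mul, smul_mul_assoc, Polynomial.coeff_add, Polynomial.coeff_C_mul,
        Polynomial.coeff_smul]
      refine add_mem ?_ (Submodule.smul_mem _ _ ?_)
      · rcases Nat.eq_zero_or_pos i with rfl | hi
        · rw [Polynomial.coeff_eq_zero_of_natDegree_lt (by omega), mul_zero]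
          exact zero_mem _
        · have := SetLike.mul_mem_graded (ι_mem_homogeneousPart_one (k := k) a)
            (ih.1 (i - 1) d (by omega))
          rwa [show 1 + (i - 1) = i by omega] at this
      · rcases d with _ | d
        · simp
        · rw [Polynomial.coeff_X_mul]
          exact ih.1 i d (by omega)
    · refine Polynomial.natDegree_mul_le.trans ?_
      rw [Nat.succ_eq_one_add]
      refine add_le_add ?_ ih.2
      refine Polynomial.natDegree_add_le_of_degree_le (by simp) ?_
      exact (Polynomial.natDegree_smul_le _ _).trans Polynomial.natDegree_X_le

theorem splitEquiv_decompose_coeff (f : CoordRing k V) {n i d : ℕ} (h : i + d = n) :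
    (splitEquiv hLH hℓ (DirectSum.decompose (homogeneousPart k V) f n)).coeff d =
      DirectSum.decompose (homogeneousPart k (V ⧸ L)) ((splitEquiv hLH hℓ f).coeff d) i := by
  induction f using DirectSum.Decomposition.inductionOn (homogeneousPart k V) with
  | zero => simp
  | add f g hf hg =>
    rw [DirectSum.decompose_add, DirectSum.add_apply, Submodule.coe_add, map_add,
      Polynomial.coeff_add, hf, hg, map_add, Polynomial.coeff_add, DirectSum.decompose_add,
      DirectSum.add_apply, Submodule.coe_add]
  | @homogeneous m f =>
    have hf := splitEquiv_coeff_mem hLH hℓ f.2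
    by_cases hm : m = n
    · subst hm
      rw [DirectSum.decompose_of_mem_same _ f.2, DirectSum.decompose_of_mem_same _ (hf.1 i d h)]
    · rw [DirectSum.decompose_of_mem_ne _ f.2 hm, map_zero, Polynomial.coeff_zero]
      by_cases hd : d ≤ m
      · rw [DirectSum.decompose_of_mem_ne _ (hf.1 (m - d) d (by omega)) (by omega)]
      · rw [Polynomial.coeff_eq_zero_of_natDegree_lt (by omega)]
        simp

theorem splitEquiv_decompose_natDegree_le (f : CoordRing k V) (n : ℕ) :
    (splitEquiv hLH hℓ (DirectSum.decompose (homogeneousPart k V) f n)).natDegree ≤ n :=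
  (splitEquiv_coeff_mem hLH hℓ (Subtype.mem _)).2

theorem isHomogeneous_leadingCoeffNth {I : Ideal (CoordRing k V)}
    (hI : I.IsHomogeneous (homogeneousPart k V)) (d : ℕ) :
    ((polyIdeal hLH hℓ I).leadingCoeffNth d).IsHomogeneous (homogeneousPart k (V ⧸ L)) := by
  intro i r hr
  obtain ⟨p, hp, hd, rfl⟩ := (mem_leadingCoeffNth_iff _ _ _).1 hr
  have hc (m j : ℕ) (h : j + m = i + d) := splitEquiv_decompose_coeff hLH hℓ
    ((splitEquiv hLH hℓ).symm p) h
  rw [AlgEquiv.apply_symm_apply] at hc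
  refine (mem_leadingCoeffNth_iff _ _ _).2 ⟨_, ?_, ?_, hc d i rfl⟩
  · rw [mem_polyIdeal, AlgEquiv.symm_apply_apply]
    exact hI _ hp
  · rw [Polynomial.natDegree_le_iff_coeff_eq_zero]
    intro m hm
    by_cases hmi : m ≤ i + d
    · rw [hc m (i + d - m) (by omega), Polynomial.coeff_eq_zero_of_natDegree_lt (by omega)]
      simp
    · exact Polynomial.coeff_eq_zero_of_natDegree_lt
        ((splitEquiv_decompose_natDegree_le hLH hℓ _ _).trans_lt (by omega))

include hLH hℓ in
theorem isHomogeneous_cylinderIdeal {J : Ideal (CoordRing k (V ⧸ L))}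
    (hJ : J.IsHomogeneous (homogeneousPart k (V ⧸ L))) :
    (cylinderIdeal L J).IsHomogeneous (homogeneousPart k V) := by
  intro n f hf
  rw [mem_cylinderIdeal_iff hLH hℓ] at hf ⊢
  intro d
  by_cases hd : d ≤ n
  · rw [splitEquiv_decompose_coeff hLH hℓ f (i := n - d) (by omega)]
    exact hJ _ (hf d)
  · rw [Polynomial.coeff_eq_zero_of_natDegree_lt
      ((splitEquiv_decompose_natDegree_le hLH hℓ _ _).trans_lt (by omega))]
    exact J.zero_mem

theorem leadingCoeffNth_cylinderIdeal (J : Ideal (CoordRing k (V ⧸ L))) (d : ℕ) :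
    (polyIdeal hLH hℓ (cylinderIdeal L J)).leadingCoeffNth d = J := by
  ext r
  rw [mem_leadingCoeffNth_iff]
  constructor
  · rintro ⟨p, hp, -, rfl⟩
    rw [mem_polyIdeal, mem_cylinderIdeal_iff hLH hℓ, AlgEquiv.apply_symm_apply] at hp
    exact hp d
  · intro hr
    refine ⟨Polynomial.monomial d r, ?_, Polynomial.natDegree_monomial_le _, by simp⟩
    rw [mem_polyIdeal, mem_cylinderIdeal_iff hLH hℓ, AlgEquiv.apply_symm_apply]
    intro n
    rw [Polynomial.coeff_monomial]
    split_ifs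
    exacts [hr, J.zero_mem]

/-- The coefficient of `ℓ ^ d`, as a linear map. -/
def splitCoeff (d : ℕ) : CoordRing k V →ₗ[k] CoordRing k (V ⧸ L) :=
  (Polynomial.lcoeff (CoordRing k (V ⧸ L)) d).restrictScalars k ∘ₗ
    (splitEquiv hLH hℓ).toLinearMap

theorem splitCoeff_apply (d : ℕ) (f : CoordRing k V) :
    splitCoeff hLH hℓ d f = (splitEquiv hLH hℓ f).coeff d := rfl

/-- The filtration of a graded part of an ideal by the degree in `ℓ`. -/
def degreeFiltration (I : Ideal (CoordRing k V)) (n m : ℕ) : Submodule k (CoordRing k V) :=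
  homogeneousPart k V n ⊓ I.restrictScalars k ⊓
    ⨅ d : Set.Ici m, LinearMap.ker (splitCoeff hLH hℓ d)

theorem mem_degreeFiltration {I : Ideal (CoordRing k V)} {n m : ℕ} {f : CoordRing k V} :
    f ∈ degreeFiltration hLH hℓ I n m ↔ f ∈ homogeneousPart k V n ∧ f ∈ I ∧
      ∀ d, m ≤ d → (splitEquiv hLH hℓ f).coeff d = 0 := by
  simp [degreeFiltration, Submodule.mem_iInf, splitCoeff_apply, and_assoc]

end Grading

section Hilbert

variable {k V : Type u} [Field k] [AddCommGroup V] [Module k V] [FiniteDimensional k V]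

instance finiteDimensional_homogeneousPart (n : ℕ) :
    FiniteDimensional k (homogeneousPart k V n) := by
  rw [← Submodule.fg_iff_finiteDimensional]
  exact Submodule.FG.pow (Submodule.fg_iff_finiteDimensional _ |>.2 inferInstance) n

theorem finrank_map_add_finrank_inf_ker {M N : Type*} [AddCommGroup M] [Module k M]
    [AddCommGroup N] [Module k N] (S : Submodule k M) [FiniteDimensional k S] (g : M →ₗ[k] N) :
    Module.finrank k (S.map g) + Module.finrank k ↥(S ⊓ LinearMap.ker g) = Module.finrank k S := by
  rw [← LinearMap.finrank_range_add_finrank_ker (g.domRestrict S), LinearMap.range_domRestrict,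
    LinearMap.ker_domRestrict, ← Submodule.finrank_map_subtype_eq, Submodule.map_comap_subtype]

/-- The dimension of the part of degree `n` of the quotient of `k[V]` by the ideal `J`, as a
codimension. -/
def gradedCodim (J : Ideal (CoordRing k V)) (n : ℕ) : ℤ :=
  Module.finrank k (homogeneousPart k V n) -
    Module.finrank k ↥(homogeneousPart k V n ⊓ J.restrictScalars k)

theorem coeff_hilbertSeries (J : Ideal (CoordRing k V)) (n : ℕ) :
    PowerSeries.coeff n (hilbertSeries J) = gradedCodim J n := by
  rw [hilbertSeries, PowerSeries.coeff_mk, gradedCodim, eq_sub_iff_add_eq,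
    ← finrank_map_add_finrank_inf_ker (homogeneousPart k V n) (Ideal.Quotient.mkₐ k J).toLinearMap]
  have : LinearMap.ker (Ideal.Quotient.mkₐ k J).toLinearMap = J.restrictScalars k := by
    ext x
    exact Ideal.Quotient.eq_zero_iff_mem
  rw [this]
  push_cast
  rfl

theorem gradedCodim_anti {J J' : Ideal (CoordRing k V)} (h : J ≤ J') (n : ℕ) :
    gradedCodim J' n ≤ gradedCodim J n := by
  have : homogeneousPart k V n ⊓ J.restrictScalars k ≤
      homogeneousPart k V n ⊓ J'.restrictScalars k := inf_le_inf_left _ h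
  have := Submodule.finrank_mono this
  rw [gradedCodim, gradedCodim]
  omega

variable {L : Submodule k V}
  {hL : Module.finrank k L = 1} {H : Submodule k V} (hLH : IsCompl L H)
  {ℓ : Module.Dual k V} (hℓ : IsLineCoord hL H ℓ)

/-- The graded pieces of the filtration by degree in `ℓ` are the graded parts of the ideals of
leading coefficients. -/
theorem finrank_degreeFiltration {I : Ideal (CoordRing k V)}
    (hI : I.IsHomogeneous (homogeneousPart k V)) (n m : ℕ) (hm : m ≤ n + 1) :
    Module.finrank k (degreeFiltration hLH hℓ I n m) = ∑ d ∈ Finset.range m,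
      Module.finrank k ↥(homogeneousPart k (V ⧸ L) (n - d) ⊓
        ((polyIdeal hLH hℓ I).leadingCoeffNth d).restrictScalars k) := by
  induction m with
  | zero =>
    have : degreeFiltration hLH hℓ I n 0 = ⊥ := by
      rw [eq_bot_iff]
      intro f hf
      have h1 := ((mem_degreeFiltration hLH hℓ).1 hf).2.2
      have h2 : splitEquiv hLH hℓ f = 0 := Polynomial.ext fun d => h1 d (Nat.zero_le d)
      simpa using h2
    rw [this, finrank_bot, Finset.range_zero, Finset.sum_empty]
  | succ m ih =>
    have : FiniteDimensional k (degreeFiltration hLH hℓ I n (m + 1)) :=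
      Submodule.finiteDimensional_of_le (S₂ := homogeneousPart k V n)
        (inf_le_left.trans inf_le_left)
    have h1 : (degreeFiltration hLH hℓ I n (m + 1)).map (splitCoeff hLH hℓ m) =
        homogeneousPart k (V ⧸ L) (n - m) ⊓
          ((polyIdeal hLH hℓ I).leadingCoeffNth m).restrictScalars k := by
      ext r
      constructor
      · rintro ⟨f, hf, rfl⟩
        obtain ⟨h1, h2, h3⟩ := (mem_degreeFiltration hLH hℓ).1 hf
        refine ⟨(splitEquiv_coeff_mem hLH hℓ h1).1 _ _ (by omega), ?_⟩
        refine (mem_leadingCoeffNth_iff _ _ _).2 ⟨splitEquiv hLH hℓ f, ?_, ?_, rfl⟩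
        · rw [mem_polyIdeal, AlgEquiv.symm_apply_apply]
          exact h2
        · exact Polynomial.natDegree_le_iff_coeff_eq_zero.2 fun d hd => h3 d hd
      · rintro ⟨h1, h2⟩
        obtain ⟨p, hp, hd, rfl⟩ := (mem_leadingCoeffNth_iff _ _ _).1 h2
        -- a homogeneous component of a function with the given initial form
        have hc (j i : ℕ) (h : i + j = n) := splitEquiv_decompose_coeff hLH hℓ
          ((splitEquiv hLH hℓ).symm p) h
        rw [AlgEquiv.apply_symm_apply] at hc
        refine ⟨DirectSum.decompose (homogeneousPart k V) ((splitEquiv hLH hℓ).symm p) n,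
          (mem_degreeFiltration hLH hℓ).2 ⟨Subtype.mem _, hI _ hp, fun d hd' => ?_⟩, ?_⟩
        · by_cases hdn : d ≤ n
          · rw [hc d (n - d) (by omega), Polynomial.coeff_eq_zero_of_natDegree_lt (by omega)]
            simp
          · exact Polynomial.coeff_eq_zero_of_natDegree_lt
              ((splitEquiv_decompose_natDegree_le hLH hℓ _ _).trans_lt (by omega))
        · rw [splitCoeff_apply, hc m (n - m) (by omega), DirectSum.decompose_of_mem_same _ h1]
    have h2 : degreeFiltration hLH hℓ I n (m + 1) ⊓ LinearMap.ker (splitCoeff hLH hℓ m) =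
        degreeFiltration hLH hℓ I n m := by
      ext f
      rw [Submodule.mem_inf, mem_degreeFiltration, mem_degreeFiltration, LinearMap.mem_ker,
        splitCoeff_apply]
      constructor
      · rintro ⟨⟨h1, h2, h3⟩, h4⟩
        refine ⟨h1, h2, fun d hd => ?_⟩
        rcases hd.eq_or_lt with rfl | hd
        exacts [h4, h3 d hd]
      · rintro ⟨h1, h2, h3⟩
        exact ⟨⟨h1, h2, fun d hd => h3 d (by omega)⟩, h3 m le_rfl⟩
    have h3 := finrank_map_add_finrank_inf_ker (degreeFiltration hLH hℓ I n (m + 1))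
      (splitCoeff hLH hℓ m)
    rw [h1, h2] at h3
    rw [Finset.sum_range_succ, ← ih (by omega), ← h3, add_comm]

theorem finrank_homogeneousPart_inf {I : Ideal (CoordRing k V)}
    (hI : I.IsHomogeneous (homogeneousPart k V)) (n : ℕ) :
    Module.finrank k ↥(homogeneousPart k V n ⊓ I.restrictScalars k) =
      ∑ d ∈ Finset.range (n + 1), Module.finrank k ↥(homogeneousPart k (V ⧸ L) (n - d) ⊓
        ((polyIdeal hLH hℓ I).leadingCoeffNth d).restrictScalars k) := by
  rw [← finrank_degreeFiltration hLH hℓ hI n (n + 1) le_rfl]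
  suffices h : homogeneousPart k V n ⊓ I.restrictScalars k =
      degreeFiltration hLH hℓ I n (n + 1) by rw [h]
  ext f
  rw [mem_degreeFiltration]
  refine ⟨fun h => ⟨h.1, h.2, fun d hd => ?_⟩, fun h => ⟨h.1, h.2.1⟩⟩
  exact Polynomial.coeff_eq_zero_of_natDegree_lt
    ((splitEquiv_coeff_mem hLH hℓ h.1).2.trans_lt (by omega))

/-- The Hilbert function of a homogeneous ideal is the sum of the Hilbert functions of the ideals
of leading coefficients. -/
theorem gradedCodim_eq_sum {I : Ideal (CoordRing k V)}
    (hI : I.IsHomogeneous (homogeneousPart k V)) (n : ℕ) :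
    gradedCodim I n = ∑ d ∈ Finset.range (n + 1),
      gradedCodim ((polyIdeal hLH hℓ I).leadingCoeffNth d) (n - d) := by
  have h1 := finrank_homogeneousPart_inf hLH hℓ hI n
  have h3 (d : ℕ) : (polyIdeal hLH hℓ (⊤ : Ideal (CoordRing k V))).leadingCoeffNth d = ⊤ := by
    rw [eq_top_iff]
    intro r _
    exact (mem_leadingCoeffNth_iff _ _ _).2 ⟨Polynomial.monomial d r, trivial,
      Polynomial.natDegree_monomial_le _, by simp⟩
  have h2 : Module.finrank k (homogeneousPart k V n) = ∑ d ∈ Finset.range (n + 1),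
      Module.finrank k (homogeneousPart k (V ⧸ L) (n - d)) := by
    have h4 := finrank_homogeneousPart_inf hLH hℓ
      (Ideal.IsHomogeneous.top (homogeneousPart k V)) n
    rw [Submodule.restrictScalars_top, inf_top_eq] at h4
    rw [h4]
    refine Finset.sum_congr rfl fun d _ => ?_
    rw [h3, Submodule.restrictScalars_top, inf_top_eq]
  simp only [gradedCodim]
  rw [h1, h2, Finset.sum_sub_distrib]
  push_cast
  rfl

end Hilbert

/-! ### Comparison of the Hilbert series -/

section Degeneration

variable {k V : Type u} [Field k] [AddCommGroup V] [Module k V]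
variable {L H : Submodule k V} {ℓ : Module.Dual k V} (hL : Module.finrank k L = 1)
variable (hLH : IsCompl L H) (hℓ : IsLineCoord hL H ℓ)
include hLH hℓ

theorem leadingCoeffNth_zero_eq_projectionIdeal (I : Ideal (CoordRing k V)) :
    (polyIdeal hLH hℓ I).leadingCoeffNth 0 = projectionIdeal L I :=
  Ideal.ext fun r => (mem_projectionIdeal_iff hLH hℓ I r).symm

theorem leadingCoeffNth_le_lambdaIdeal (I : Ideal (CoordRing k V)) (d : ℕ) :
    (polyIdeal hLH hℓ I).leadingCoeffNth d ≤ lambdaIdeal L hL I := fun r hr =>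
  (mem_lambdaIdeal_iff hLH hℓ I r).2 ((mem_leadingCoeff_iff_exists _ _).2 ⟨d, hr⟩)

/-- If the flat limit is the whole union, then all leading coefficients occur already in
degree one. -/
theorem leadingCoeffNth_succ_eq_lambdaIdeal {I : Ideal (CoordRing k V)}
    (h : flatLimitIdeal hLH I =
      horizontalIdeal hLH (projectionIdeal L I) ⊓ cylinderIdeal L (lambdaIdeal L hL I)) (d : ℕ) :
    (polyIdeal hLH hℓ I).leadingCoeffNth (d + 1) = lambdaIdeal L hL I := by
  refine le_antisymm (leadingCoeffNth_le_lambdaIdeal hL hLH hℓ I _) fun r hr => ?_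
  have h1 : (splitEquiv hLH hℓ).symm (Polynomial.monomial (d + 1) r) ∈ flatLimitIdeal hLH I := by
    rw [h]
    refine ⟨(mem_horizontalIdeal_iff hLH hℓ _ _).2 ?_,
      (mem_cylinderIdeal_iff hLH hℓ _ _).2 fun n => ?_⟩
    · simp [Polynomial.coeff_monomial]
    · rw [AlgEquiv.apply_symm_apply, Polynomial.coeff_monomial]
      split_ifs
      exacts [hr, zero_mem _]
  have h2 := (mem_flatLimitIdeal_iff hLH hℓ _ _).1 h1 (d + 1)
  rwa [AlgEquiv.apply_symm_apply, Polynomial.coeff_monomial_same] at h2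

theorem isHomogeneous_projectionIdeal {I : Ideal (CoordRing k V)}
    (hI : I.IsHomogeneous (homogeneousPart k V)) :
    (projectionIdeal L I).IsHomogeneous (homogeneousPart k (V ⧸ L)) := by
  rw [← leadingCoeffNth_zero_eq_projectionIdeal hL hLH hℓ]
  exact isHomogeneous_leadingCoeffNth hLH hℓ hI 0

theorem isHomogeneous_lambdaIdeal {I : Ideal (CoordRing k V)}
    (hI : I.IsHomogeneous (homogeneousPart k V)) :
    (lambdaIdeal L hL I).IsHomogeneous (homogeneousPart k (V ⧸ L)) := by
  intro i r hr
  obtain ⟨d, hd⟩ := (mem_leadingCoeff_iff_exists _ _).1 ((mem_lambdaIdeal_iff hLH hℓ I r).1 hr)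
  exact leadingCoeffNth_le_lambdaIdeal hL hLH hℓ I d
    (isHomogeneous_leadingCoeffNth hLH hℓ hI d i hd)

variable [FiniteDimensional k V]

theorem gradedCodim_zero_eq {I : Ideal (CoordRing k V)}
    (hI : I.IsHomogeneous (homogeneousPart k V)) :
    gradedCodim I 0 = gradedCodim (projectionIdeal L I) 0 := by
  rw [gradedCodim_eq_sum hLH hℓ hI, zero_add, Finset.sum_range_one,
    leadingCoeffNth_zero_eq_projectionIdeal]

theorem gradedCodim_succ_eq {I : Ideal (CoordRing k V)}
    (hI : I.IsHomogeneous (homogeneousPart k V)) (n : ℕ) :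
    gradedCodim I (n + 1) = gradedCodim (projectionIdeal L I) (n + 1) +
      ∑ d ∈ Finset.range (n + 1),
        gradedCodim ((polyIdeal hLH hℓ I).leadingCoeffNth (d + 1)) (n - d) := by
  rw [gradedCodim_eq_sum hLH hℓ hI, Finset.sum_range_succ',
    leadingCoeffNth_zero_eq_projectionIdeal, Nat.sub_zero, add_comm]
  simp only [Nat.add_sub_add_right]

theorem gradedCodim_cylinderIdeal {J : Ideal (CoordRing k (V ⧸ L))}
    (hJ : J.IsHomogeneous (homogeneousPart k (V ⧸ L))) (n : ℕ) :
    gradedCodim (cylinderIdeal L J) n = ∑ d ∈ Finset.range (n + 1), gradedCodim J (n - d) := by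
  rw [gradedCodim_eq_sum hLH hℓ (isHomogeneous_cylinderIdeal hLH hℓ hJ)]
  simp only [leadingCoeffNth_cylinderIdeal]

/-- Multiplication by `1 - s` turns the Hilbert series of `Z × L` into that of `Z`. -/
theorem gradedCodim_cylinderIdeal_succ {J : Ideal (CoordRing k (V ⧸ L))}
    (hJ : J.IsHomogeneous (homogeneousPart k (V ⧸ L))) (n : ℕ) :
    gradedCodim (cylinderIdeal L J) (n + 1) =
      gradedCodim (cylinderIdeal L J) n + gradedCodim J (n + 1) := by
  rw [gradedCodim_cylinderIdeal hL hLH hℓ hJ, gradedCodim_cylinderIdeal hL hLH hℓ hJ,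
    Finset.sum_range_succ', Nat.sub_zero]
  simp only [Nat.add_sub_add_right]

theorem coeff_zero_union {J₀ J : Ideal (CoordRing k (V ⧸ L))}
    (hJ₀ : J₀.IsHomogeneous (homogeneousPart k (V ⧸ L))) :
    PowerSeries.coeff 0 ((1 - PowerSeries.X) * hilbertSeries (cylinderIdeal L J₀) +
      PowerSeries.X * hilbertSeries (cylinderIdeal L J)) = gradedCodim J₀ 0 := by
  rw [sub_mul, one_mul, map_add, map_sub, PowerSeries.coeff_zero_X_mul,
    PowerSeries.coeff_zero_X_mul, coeff_hilbertSeries, gradedCodim_cylinderIdeal hL hLH hℓ hJ₀]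
  simp

theorem coeff_succ_union {J₀ J : Ideal (CoordRing k (V ⧸ L))}
    (hJ₀ : J₀.IsHomogeneous (homogeneousPart k (V ⧸ L)))
    (hJ : J.IsHomogeneous (homogeneousPart k (V ⧸ L))) (n : ℕ) :
    PowerSeries.coeff (n + 1) ((1 - PowerSeries.X) * hilbertSeries (cylinderIdeal L J₀) +
      PowerSeries.X * hilbertSeries (cylinderIdeal L J)) =
        gradedCodim J₀ (n + 1) + ∑ d ∈ Finset.range (n + 1), gradedCodim J (n - d) := by
  rw [sub_mul, one_mul, map_add, map_sub, PowerSeries.coeff_succ_X_mul,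
    PowerSeries.coeff_succ_X_mul, coeff_hilbertSeries, coeff_hilbertSeries, coeff_hilbertSeries,
    gradedCodim_cylinderIdeal_succ hL hLH hℓ hJ₀, ← gradedCodim_cylinderIdeal hL hLH hℓ hJ]
  ring

theorem hilbertSeries_union_le {I : Ideal (CoordRing k V)}
    (hI : I.IsHomogeneous (homogeneousPart k V)) (n : ℕ) :
    PowerSeries.coeff n
        ((1 - PowerSeries.X) * hilbertSeries (cylinderIdeal L (projectionIdeal L I)) +
          PowerSeries.X * hilbertSeries (cylinderIdeal L (lambdaIdeal L hL I))) ≤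
      PowerSeries.coeff n (hilbertSeries I) := by
  have h0 := isHomogeneous_projectionIdeal hL hLH hℓ hI
  rw [coeff_hilbertSeries]
  cases n with
  | zero => rw [coeff_zero_union hL hLH hℓ h0, gradedCodim_zero_eq hL hLH hℓ hI]
  | succ n =>
    rw [coeff_succ_union hL hLH hℓ h0 (isHomogeneous_lambdaIdeal hL hLH hℓ hI),
      gradedCodim_succ_eq hL hLH hℓ hI]
    gcongr with d
    exact gradedCodim_anti (leadingCoeffNth_le_lambdaIdeal hL hLH hℓ I _) _

theorem hilbertSeries_eq_union {I : Ideal (CoordRing k V)}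
    (hI : I.IsHomogeneous (homogeneousPart k V))
    (h : flatLimitIdeal hLH I =
      horizontalIdeal hLH (projectionIdeal L I) ⊓ cylinderIdeal L (lambdaIdeal L hL I)) :
    hilbertSeries I =
      (1 - PowerSeries.X) * hilbertSeries (cylinderIdeal L (projectionIdeal L I)) +
        PowerSeries.X * hilbertSeries (cylinderIdeal L (lambdaIdeal L hL I)) := by
  have h0 := isHomogeneous_projectionIdeal hL hLH hℓ hI
  ext n
  rw [coeff_hilbertSeries]
  cases n with
  | zero => rw [coeff_zero_union hL hLH hℓ h0, gradedCodim_zero_eq hL hLH hℓ hI]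
  | succ n =>
    rw [coeff_succ_union hL hLH hℓ h0 (isHomogeneous_lambdaIdeal hL hLH hℓ hI),
      gradedCodim_succ_eq hL hLH hℓ hI]
    simp only [leadingCoeffNth_succ_eq_lambdaIdeal hL hLH hℓ h]

end Degeneration

end LineDegeneration

end

theorem mainTheorem6 {k V : Type u} [Field k] [AddCommGroup V] [Module k V]
    [FiniteDimensional k V] (L : Submodule k V) (hL : Module.finrank k L = 1)
    (I : Ideal (LineDegeneration.CoordRing k V)) :
    (∀ (H : Submodule k V) (hLH : IsCompl L H),
      -- the subschemes `Π × {0}` and `Λ × L` of `V` meet in `Λ × {0}`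
      LineDegeneration.horizontalIdeal hLH (LineDegeneration.projectionIdeal L I) ⊔
          LineDegeneration.cylinderIdeal L (LineDegeneration.lambdaIdeal L hL I) =
        LineDegeneration.horizontalIdeal hLH (LineDegeneration.lambdaIdeal L hL I) ∧
      -- the flat limit contains their union
      LineDegeneration.flatLimitIdeal hLH I ≤
        LineDegeneration.horizontalIdeal hLH (LineDegeneration.projectionIdeal L I) ⊓
          LineDegeneration.cylinderIdeal L (LineDegeneration.lambdaIdeal L hL I) ∧
      -- and it is equal to their union as a set
      PrimeSpectrum.zeroLocus (LineDegeneration.flatLimitIdeal hLH I : Set (LineDegeneration.CoordRing k V)) =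
        PrimeSpectrum.zeroLocus
            (LineDegeneration.horizontalIdeal hLH
              (LineDegeneration.projectionIdeal L I) : Set (LineDegeneration.CoordRing k V)) ∪
          PrimeSpectrum.zeroLocus
            (LineDegeneration.cylinderIdeal L
              (LineDegeneration.lambdaIdeal L hL I) : Set (LineDegeneration.CoordRing k V))) ∧
    -- the homogeneous case
    (I.IsHomogeneous (LineDegeneration.homogeneousPart k V) →
      (LineDegeneration.projectionIdeal L I).IsHomogeneous
          (LineDegeneration.homogeneousPart k (V ⧸ L)) ∧
        (LineDegeneration.lambdaIdeal L hL I).IsHomogeneous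
          (LineDegeneration.homogeneousPart k (V ⧸ L)) ∧
        ∀ n : ℕ,
          PowerSeries.coeff n
              ((1 - PowerSeries.X) * LineDegeneration.hilbertSeries
                  (LineDegeneration.cylinderIdeal L (LineDegeneration.projectionIdeal L I)) +
                PowerSeries.X * LineDegeneration.hilbertSeries
                  (LineDegeneration.cylinderIdeal L (LineDegeneration.lambdaIdeal L hL I))) ≤
            PowerSeries.coeff n (LineDegeneration.hilbertSeries I)) ∧
    -- the case of a reduced flat limit
    (∀ (H : Submodule k V) (hLH : IsCompl L H),
      IsReduced (LineDegeneration.CoordRing k V ⧸ LineDegeneration.flatLimitIdeal hLH I) →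
        LineDegeneration.flatLimitIdeal hLH I =
            LineDegeneration.horizontalIdeal hLH (LineDegeneration.projectionIdeal L I) ⊓
              LineDegeneration.cylinderIdeal L (LineDegeneration.lambdaIdeal L hL I) ∧
          (I.IsHomogeneous (LineDegeneration.homogeneousPart k V) →
            LineDegeneration.hilbertSeries I =
              (1 - PowerSeries.X) * LineDegeneration.hilbertSeries
                  (LineDegeneration.cylinderIdeal L (LineDegeneration.projectionIdeal L I)) +
                PowerSeries.X * LineDegeneration.hilbertSeries
                  (LineDegeneration.cylinderIdeal L (LineDegeneration.lambdaIdeal L hL I)))) := by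
  refine ⟨fun H hLH => ⟨LineDegeneration.horizontal_sup_cylinder hL hLH
      (LineDegeneration.projectionIdeal_le_lambdaIdeal hL hLH I),
      LineDegeneration.flatLimitIdeal_le hL hLH I,
      LineDegeneration.zeroLocus_flatLimitIdeal hL hLH I⟩, fun hI => ?_, fun H hLH h => ?_⟩
  · obtain ⟨H, hLH⟩ := Submodule.exists_isCompl L
    obtain ⟨ℓ, hℓ⟩ := LineDegeneration.exists_isLineCoord hL hLH
    exact ⟨LineDegeneration.isHomogeneous_projectionIdeal hL hLH hℓ hI,
      LineDegeneration.isHomogeneous_lambdaIdeal hL hLH hℓ hI,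
      LineDegeneration.hilbertSeries_union_le hL hLH hℓ hI⟩
  · obtain ⟨ℓ, hℓ⟩ := LineDegeneration.exists_isLineCoord hL hLH
    have h1 := LineDegeneration.flatLimitIdeal_eq_of_isReduced hL hLH I h
    exact ⟨h1, fun hI => LineDegeneration.hilbertSeries_eq_union hL hLH hℓ hI h1⟩
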